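/- Let $k$ be an algebraically closed field, complete with respect to a non-archimedean absolute value $|\cdot|$, whose residue field has characteristic zero, and let $q\ge 1$ be an integer. Let $\mathcal A$ be a $k$-analytic (Berkovich) annulus, closed, open or semi-open: for an interval $I\subset(0,\infty)$ of the form $[r,R]$, $(r,R)$, $[r,R)$ or $(r,R]$ with $0\le r<R<\infty$ (the case $r=0$, where $I=(0,R)$ or $(0,R]$, being that of a punctured disc), $\mathcal A=\mathcal A_I$ is the space $\{x : |s|_x\in I\}$, with ring of functions $$\mathcal O(\mathcal A_I)=\Big\{\sum_{i\in\mathbb Z}a_is^i : a_i\in k,\ |a_i|\rho^i\to 0 \text{ as } |i|\to\infty \text{ for every } \rho\in I\Big\}.$$ A coordinate on $\mathcal A$ is an analytic function on $\mathcal A$ that induces an isomorphism of $\mathcal A$ onto an annulus $\mathcal A_J$ with $J$ an interval of the same kind. Let $\xi$ be a $q$-differential on $\mathcal A$, that is, a section of $(\Omega^1_{\mathcal A})^{\otimes q}$, that has neither zeros nor poles on $\mathcal A$. Then there is a coordinate $t$ on $\mathcal A$ for which at least one of the following holds: 1. there are an integer $n\neq 0$ divisible by $q$ and $c_n,c_0\in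 k$ such that $$\xi=\big(c_nt^{n/q}+c_0\big)^q\Big(\frac{dt}{t}\Big)^q \quad\text{and}\quad |c_nt^{n/q}|_x>|c_0|_x \text{ for all } x\in\mathcal A;$$ 2. there are an integer $n$ and $c_n\in k$ such that $$\xi=c_n^q\,t^n\Big(\frac{dt}{t}\Big)^q.$$ -/

import Mathlib

open Filter Topology

noncomputable section

/-- The set of radii of an annulus: a closed, open or semi-open interval of positive reals with
end points `r < R`. For `r = 0` positivity leaves the intervals `(0, R)` and
`(0, R]`, which give the punctured discs. -/
structure RadiusInterval where
  carrier : Set ℝ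
  pos : ∀ ρ ∈ carrier, 0 < ρ
  shape : ∃ r R : ℝ, 0 ≤ r ∧ r < R ∧
    (carrier = Set.Icc r R ∨ carrier = Set.Ioo r R ∨ carrier = Set.Ico r R ∨ carrier = Set.Ioc r R)

namespace RadiusInterval

instance : Membership ℝ RadiusInterval := ⟨fun I ρ => ρ ∈ I.carrier⟩

theorem exists_mem (I : RadiusInterval) : ∃ ρ : ℝ, ρ ∈ I := by
  obtain ⟨r, R, _, h, h' | h' | h' | h'⟩ := I.shape
  · exact ⟨r, show r ∈ I.carrier by rw [h']; exact ⟨le_rfl, h.le⟩⟩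
  · obtain ⟨m, hm⟩ := exists_between h
    exact ⟨m, show m ∈ I.carrier by rw [h']; exact hm⟩
  · exact ⟨r, show r ∈ I.carrier by rw [h']; exact ⟨le_rfl, h⟩⟩
  · exact ⟨R, show R ∈ I.carrier by rw [h']; exact ⟨h, le_rfl⟩⟩

end RadiusInterval

/-- Two-sided sequences `a` such that the Laurent series `∑ aᵢ Tⁱ` converges at every radius
in `I`. -/
def convergentLaurent (k : Type*) [NormedField k] (I : RadiusInterval) : Submodule k (ℤ → k) where
  carrier := {a | ∀ ρ ∈ I, Tendsto (fun i : ℤ => ‖a i‖ * ρ ^ i) cofinite (𝓝 0)}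
  zero_mem' := by
    intro ρ _
    simp
  add_mem' := by
    intro a b ha hb ρ hρ
    have h := (ha ρ hρ).add (hb ρ hρ)
    rw [add_zero] at h
    refine squeeze_zero (fun i => ?_) (fun i => ?_) h
    · exact mul_nonneg (norm_nonneg _) (zpow_nonneg (I.pos ρ hρ).le _)
    · rw [← add_mul]
      exact mul_le_mul_of_nonneg_right (norm_add_le _ _) (zpow_nonneg (I.pos ρ hρ).le _)
  smul_mem' := by
    intro c a ha ρ hρ
    have h := (ha ρ hρ).const_mul ‖c‖
    rw [mul_zero] at h
    refine h.congr (fun i => ?_)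
    simp [mul_assoc]

/-- The ring `𝒪(𝒜_I)` of analytic functions on the annulus `𝒜_I = {|T| ∈ I}`: the Laurent series
`∑ aᵢ Tⁱ` over `k` converging on `I`, with the Cauchy product. -/
def AnalyticFunction (k : Type*) [NormedField k] (I : RadiusInterval) : Type _ :=
  convergentLaurent k I

namespace AnalyticFunction

variable {k : Type*} [NormedField k] {I : RadiusInterval}

instance : AddCommGroup (AnalyticFunction k I) := inferInstanceAs (AddCommGroup (convergentLaurent k I))

instance : Module k (AnalyticFunction k I) := inferInstanceAs (Module k (convergentLaurent k I))

/-- The `i`-th Laurent coefficient. -/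
def coeff (f : AnalyticFunction k I) (i : ℤ) : k := f.1 i

theorem tendsto_coeff (f : AnalyticFunction k I) {ρ : ℝ} (hρ : ρ ∈ I) :
    Tendsto (fun i : ℤ => ‖f.coeff i‖ * ρ ^ i) cofinite (𝓝 0) := f.2 ρ hρ

@[ext]
theorem ext {f g : AnalyticFunction k I} (h : ∀ i, f.coeff i = g.coeff i) : f = g :=
  Subtype.ext (funext h)

@[simp]
theorem coeff_zero (i : ℤ) : (0 : AnalyticFunction k I).coeff i = 0 := rfl

@[simp]
theorem coeff_add (f g : AnalyticFunction k I) (i : ℤ) :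
    (f + g).coeff i = f.coeff i + g.coeff i := rfl

@[simp]
theorem coeff_smul (c : k) (f : AnalyticFunction k I) (i : ℤ) :
    (c • f).coeff i = c * f.coeff i := rfl

/-- The monomial `c Tⁿ`. -/
def monomial (n : ℤ) (c : k) : AnalyticFunction k I :=
  ⟨Pi.single n c, fun ρ _ => by
    refine tendsto_const_nhds.congr' ?_
    have h : ∀ᶠ i : ℤ in cofinite, i ≠ n := by
      simpa using (Set.finite_singleton n).compl_mem_cofinite
    filter_upwards [h] with i hi
    simp [Pi.single_eq_of_ne hi]⟩

theorem coeff_monomial (n : ℤ) (c : k) (i : ℤ) :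
    (monomial n c : AnalyticFunction k I).coeff i = if i = n then c else 0 := by
  simp [monomial, coeff, Pi.single_apply]

/-- The Gauss norm `|f|_ρ = maxᵢ |aᵢ| ρⁱ`. -/
def gaussNorm (ρ : ℝ) (f : AnalyticFunction k I) : ℝ := ⨆ i : ℤ, ‖f.coeff i‖ * ρ ^ i

variable [IsUltrametricDist k]

theorem tendsto_mul_coeff (f g : AnalyticFunction k I) {ρ : ℝ} (hρ : ρ ∈ I) :
    Tendsto (fun p : ℤ × ℤ => ‖f.coeff p.1 * g.coeff p.2‖ * ρ ^ (p.1 + p.2)) cofinite (𝓝 0) := by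
  refine (tendsto_mul_cofinite_nhds_zero (f.tendsto_coeff hρ) (g.tendsto_coeff hρ)).congr ?_
  intro p
  rw [norm_mul, zpow_add₀ (I.pos ρ hρ).ne']
  ring

theorem tendsto_of_mul_zpow {α : Type*} {F : α → k} {ρ : ℝ} (hρ : 0 < ρ) (n : ℤ)
    (h : Tendsto (fun i => ‖F i‖ * ρ ^ n) cofinite (𝓝 0)) : Tendsto F cofinite (𝓝 0) := by
  rw [tendsto_zero_iff_norm_tendsto_zero]
  have h' := h.mul_const (ρ ^ n)⁻¹
  rw [zero_mul] at h'
  refine h'.congr (fun i => ?_)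
  rw [mul_assoc, mul_inv_cancel₀ (zpow_pos hρ n).ne', mul_one]

theorem antidiagonal_injective (n : ℤ) : Function.Injective (fun i : ℤ => (i, n - i)) :=
  fun _ _ h => (Prod.mk.inj h).1

variable [CompleteSpace k]

theorem summable_mul (f g : AnalyticFunction k I) (n : ℤ) :
    Summable (fun i : ℤ => f.coeff i * g.coeff (n - i)) := by
  obtain ⟨ρ, hρ⟩ := I.exists_mem
  refine NonarchimedeanAddGroup.summable_of_tendsto_cofinite_zero
    (tendsto_of_mul_zpow (I.pos ρ hρ) n ?_)
  refine ((f.tendsto_mul_coeff g hρ).comp (antidiagonal_injective n).tendsto_cofinite).congr ?_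
  intro i
  simp

theorem norm_tsum_le_of_forall_le {α : Type*} {F : α → k} {C : ℝ} (hC : 0 ≤ C)
    (h : ∀ i, ‖F i‖ ≤ C) : ‖∑' i, F i‖ ≤ C := by
  by_cases hF : Summable F
  · refine le_of_tendsto hF.hasSum.norm (Eventually.of_forall fun s => ?_)
    exact IsUltrametricDist.norm_sum_le_of_forall_le_of_nonneg hC (fun i _ => h i)
  · simpa [tsum_eq_zero_of_not_summable hF] using hC

/-- The Cauchy product. -/
instance : Mul (AnalyticFunction k I) where
  mul f g := ⟨fun n => ∑' i : ℤ, f.coeff i * g.coeff (n - i), by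
    intro ρ hρ
    have hpos := I.pos ρ hρ
    rw [Metric.tendsto_nhds]
    intro ε hε
    have h := (Metric.tendsto_nhds.1 (f.tendsto_mul_coeff g hρ)) (ε / 2) (half_pos hε)
    rw [eventually_cofinite] at h ⊢
    refine (h.image (fun p : ℤ × ℤ => p.1 + p.2)).subset ?_
    intro n hn
    by_contra hcon
    apply hn
    have key : ∀ i : ℤ, ‖f.coeff i * g.coeff (n - i)‖ ≤ ε / 2 / ρ ^ n := by
      intro i
      by_contra hi
      apply hcon
      refine ⟨(i, n - i), ?_, by simp⟩
      intro hlt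
      apply hi
      rw [le_div_iff₀ (zpow_pos hpos n)]
      rw [dist_zero_right, Real.norm_of_nonneg
        (mul_nonneg (norm_nonneg _) (zpow_nonneg hpos.le _))] at hlt
      simpa using hlt.le
    have h2 := norm_tsum_le_of_forall_le (div_nonneg (half_pos hε).le (zpow_pos hpos n).le) key
    rw [le_div_iff₀ (zpow_pos hpos n)] at h2
    rw [dist_zero_right, Real.norm_of_nonneg
      (mul_nonneg (norm_nonneg _) (zpow_nonneg hpos.le _))]
    exact h2.trans_lt (half_lt_self hε)⟩

theorem coeff_mul (f g : AnalyticFunction k I) (n : ℤ) :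
    (f * g).coeff n = ∑' i : ℤ, f.coeff i * g.coeff (n - i) := rfl

instance : One (AnalyticFunction k I) := ⟨monomial 0 1⟩

theorem one_def : (1 : AnalyticFunction k I) = monomial 0 1 := rfl

theorem coeff_monomial_mul (m : ℤ) (c : k) (f : AnalyticFunction k I) (n : ℤ) :
    (monomial m c * f).coeff n = c * f.coeff (n - m) := by
  rw [coeff_mul, tsum_eq_single m]
  · simp [coeff_monomial]
  · intro i hi
    simp [coeff_monomial, hi]

theorem mul_comm_aux (f g : AnalyticFunction k I) : f * g = g * f := by
  ext n
  rw [coeff_mul, coeff_mul, ← (Equiv.subLeft n).tsum_eq]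
  refine tsum_congr (fun i => ?_)
  simp [mul_comm]

theorem mul_assoc_aux (f g h : AnalyticFunction k I) : f * g * h = f * (g * h) := by
  ext n
  obtain ⟨ρ, hρ⟩ := I.exists_mem
  have hpos := I.pos ρ hρ
  have hsum : Summable (fun p : ℤ × ℤ =>
      f.coeff p.1 * g.coeff (p.2 - p.1) * h.coeff (n - p.2)) := by
    refine NonarchimedeanAddGroup.summable_of_tendsto_cofinite_zero
      (tendsto_of_mul_zpow hpos n ?_)
    obtain ⟨C, hC⟩ := (h.tendsto_coeff hρ).bddAbove_range_of_cofinite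
    have hinj : Function.Injective (fun p : ℤ × ℤ => (p.1, p.2 - p.1)) := by
      rintro ⟨a, b⟩ ⟨c, d⟩ hh
      simp only [Prod.mk.injEq] at hh ⊢
      omega
    have h1 := ((f.tendsto_mul_coeff g hρ).comp hinj.tendsto_cofinite).mul_const C
    rw [zero_mul] at h1
    refine squeeze_zero (fun p => mul_nonneg (norm_nonneg _) (zpow_nonneg hpos.le _)) ?_ h1
    intro p
    have h2 : ‖h.coeff (n - p.2)‖ * ρ ^ (n - p.2) ≤ C := hC ⟨n - p.2, rfl⟩
    have h3 : ρ ^ n = ρ ^ p.2 * ρ ^ (n - p.2) := by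
      rw [← zpow_add₀ hpos.ne']
      congr 1
      ring
    have h4 : p.1 + (p.2 - p.1) = p.2 := by ring
    simp only [Function.comp_apply, h4]
    rw [norm_mul, h3]
    calc ‖f.coeff p.1 * g.coeff (p.2 - p.1)‖ * ‖h.coeff (n - p.2)‖ * (ρ ^ p.2 * ρ ^ (n - p.2))
        = ‖f.coeff p.1 * g.coeff (p.2 - p.1)‖ * ρ ^ p.2 *
          (‖h.coeff (n - p.2)‖ * ρ ^ (n - p.2)) := by ring
      _ ≤ _ := mul_le_mul_of_nonneg_left h2
          (mul_nonneg (norm_nonneg _) (zpow_nonneg hpos.le _))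
  have hl : (f * g * h).coeff n =
      ∑' j : ℤ, ∑' i : ℤ, f.coeff i * g.coeff (j - i) * h.coeff (n - j) := by
    rw [coeff_mul]
    refine tsum_congr (fun j => ?_)
    rw [coeff_mul, tsum_mul_right]
  have hr : (f * (g * h)).coeff n =
      ∑' i : ℤ, ∑' j : ℤ, f.coeff i * g.coeff (j - i) * h.coeff (n - j) := by
    rw [coeff_mul]
    refine tsum_congr (fun i => ?_)
    rw [coeff_mul, ← tsum_mul_left, ← (Equiv.subRight i).tsum_eq]
    refine tsum_congr (fun j => ?_)
    rw [← mul_assoc]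
    congr 2
    simp
  rw [hl, hr]
  exact (Summable.tsum_comm (f := fun i j : ℤ =>
    f.coeff i * g.coeff (j - i) * h.coeff (n - j)) hsum)

theorem one_mul_aux (f : AnalyticFunction k I) : 1 * f = f := by
  ext n
  simp [one_def, coeff_monomial_mul]

theorem add_mul_aux (f g h : AnalyticFunction k I) : (f + g) * h = f * h + g * h := by
  ext n
  rw [coeff_add, coeff_mul, coeff_mul, coeff_mul,
    ← (summable_mul f h n).tsum_add (summable_mul g h n)]
  refine tsum_congr (fun i => ?_)
  rw [coeff_add, add_mul]

theorem zero_mul_aux (f : AnalyticFunction k I) : 0 * f = 0 := by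
  ext n
  simp [coeff_mul]

instance : CommRing (AnalyticFunction k I) where
  mul_assoc := mul_assoc_aux
  one_mul := one_mul_aux
  mul_one f := by rw [mul_comm_aux, one_mul_aux]
  left_distrib f g h := by
    rw [mul_comm_aux, add_mul_aux, mul_comm_aux g, mul_comm_aux h]
  right_distrib := add_mul_aux
  zero_mul := zero_mul_aux
  mul_zero f := by rw [mul_comm_aux, zero_mul_aux]
  mul_comm := mul_comm_aux
  zsmul := (inferInstance : AddCommGroup (AnalyticFunction k I)).zsmul
  nsmul := (inferInstance : AddCommGroup (AnalyticFunction k I)).nsmul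
  zsmul_zero' := (inferInstance : AddCommGroup (AnalyticFunction k I)).zsmul_zero'
  zsmul_succ' := (inferInstance : AddCommGroup (AnalyticFunction k I)).zsmul_succ'
  zsmul_neg' := (inferInstance : AddCommGroup (AnalyticFunction k I)).zsmul_neg'
  nsmul_zero := (inferInstance : AddCommGroup (AnalyticFunction k I)).nsmul_zero
  nsmul_succ := (inferInstance : AddCommGroup (AnalyticFunction k I)).nsmul_succ
  neg_add_cancel := neg_add_cancel
  sub_eq_add_neg := sub_eq_add_neg

theorem smul_mul_aux (c : k) (f g : AnalyticFunction k I) : c • f * g = c • (f * g) := by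
  ext n
  rw [coeff_smul, coeff_mul, coeff_mul, ← tsum_mul_left]
  refine tsum_congr (fun i => ?_)
  rw [coeff_smul, mul_assoc]

instance : Algebra k (AnalyticFunction k I) :=
  Algebra.ofModule smul_mul_aux (fun c f g => by rw [mul_comm, smul_mul_aux, mul_comm])

/-- The standard coordinate function `T` of `𝒜_I`. -/
def T : AnalyticFunction k I := monomial 1 1

/-- The derivative `f' = ∑ i aᵢ Tⁱ⁻¹` with respect to the standard coordinate. -/
def derivative (f : AnalyticFunction k I) : AnalyticFunction k I :=
  ⟨fun n => ((n + 1 : ℤ) : k) * f.coeff (n + 1), by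
    intro ρ hρ
    have hpos := I.pos ρ hρ
    have h := ((f.tendsto_coeff hρ).comp (add_left_injective (1 : ℤ)).tendsto_cofinite).mul_const
      ρ⁻¹
    rw [zero_mul] at h
    refine squeeze_zero (fun i => mul_nonneg (norm_nonneg _) (zpow_nonneg hpos.le _)) ?_ h
    intro i
    have h1 : ‖((i + 1 : ℤ) : k)‖ ≤ 1 := IsUltrametricDist.norm_intCast_le_one k (i + 1)
    have h2 : ρ ^ (i + 1) * ρ⁻¹ = ρ ^ i := by
      rw [zpow_add_one₀ hpos.ne', mul_assoc, mul_inv_cancel₀ hpos.ne', mul_one]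
    simp only [Function.comp_apply]
    rw [norm_mul, mul_assoc, mul_assoc, h2]
    exact mul_le_of_le_one_left (mul_nonneg (norm_nonneg _) (zpow_nonneg hpos.le _)) h1⟩

theorem coeff_derivative (f : AnalyticFunction k I) (n : ℤ) :
    (derivative f).coeff n = ((n + 1 : ℤ) : k) * f.coeff (n + 1) := rfl

theorem hasSum_coeff_mul (f g : AnalyticFunction k I) (n : ℤ) :
    HasSum (fun i : ℤ => f.coeff i * g.coeff (n - i)) ((f * g).coeff n) :=
  (summable_mul f g n).hasSum

theorem hasSum_shift {F : ℤ → k} {a : k} (h : HasSum F a) : HasSum (fun i => F (i + 1)) a :=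
  (Equiv.addRight (1 : ℤ)).hasSum_iff.2 h

theorem derivative_mul (f g : AnalyticFunction k I) :
    derivative (f * g) = f * derivative g + g * derivative f := by
  ext n
  have h1 := hasSum_shift (hasSum_coeff_mul f (derivative g) n)
  have h2 := hasSum_coeff_mul (derivative f) g n
  have h3 := hasSum_shift (hasSum_coeff_mul f g (n + 1))
  rw [mul_comm g, coeff_add, coeff_derivative]
  refine (h3.mul_left ((n + 1 : ℤ) : k)).unique ?_
  have h4 := h1.add h2
  have e : (fun i : ℤ => ((n + 1 : ℤ) : k) * (f.coeff (i + 1) * g.coeff (n + 1 - (i + 1)))) =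
      fun i : ℤ => f.coeff (i + 1) * (derivative g).coeff (n - (i + 1)) +
        (derivative f).coeff i * g.coeff (n - i) := by
    funext i
    have e1 : n + 1 - (i + 1) = n - i := by ring
    have e2 : n - (i + 1) + 1 = n - i := by ring
    rw [coeff_derivative, coeff_derivative, e1, e2]
    push_cast
    ring
  rw [e]
  exact h4

end AnalyticFunction

section Annulus

variable (k : Type*) [NormedField k] [IsUltrametricDist k] [CompleteSpace k]

/-- The Berkovich annulus `𝒜_I`, as the union over all closed subintervals `[r, R] ⊆ I` of the
Berkovich spectra of the affinoid algebras `k{R⁻¹T, rT⁻¹}`, whose norm is the maximum of the Gauss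
norms at `r` and `R`: a point is a multiplicative seminorm `f ↦ |f|_x` bounded by such a norm. It
automatically extends the absolute value of `k`. -/
structure BerkovichAnnulus (I : RadiusInterval) extends MulRingSeminorm (AnalyticFunction k I) where
  bounded : ∃ r ∈ I, ∃ R ∈ I, r ≤ R ∧
    ∀ f : AnalyticFunction k I, toFun f ≤ max (f.gaussNorm r) (f.gaussNorm R)

variable {k} {I : RadiusInterval}

/-- The absolute value `|f|_x` of a function at a point. -/
def absAt (x : BerkovichAnnulus k I) (f : AnalyticFunction k I) : ℝ := x.toMulRingSeminorm f

/-- The ideal of the functions vanishing at `x`. -/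
def vanishingIdeal (x : BerkovichAnnulus k I) : Ideal (AnalyticFunction k I) where
  carrier := {f | absAt x f = 0}
  zero_mem' := map_zero x.toMulRingSeminorm
  add_mem' := by
    intro f g hf hg
    have h1 : absAt x (f + g) ≤ absAt x f + absAt x g := map_add_le_add x.toMulRingSeminorm f g
    have h2 : 0 ≤ absAt x (f + g) := apply_nonneg x.toMulRingSeminorm (f + g)
    have hf' : absAt x f = 0 := hf
    have hg' : absAt x g = 0 := hg
    rw [hf', hg', add_zero] at h1
    exact le_antisymm h1 h2
  smul_mem' := by
    intro c f hf
    have h1 : absAt x (c * f) = absAt x c * absAt x f := map_mul x.toMulRingSeminorm c f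
    have hf' : absAt x f = 0 := hf
    rw [hf', mul_zero] at h1
    exact h1

/-- An analytic function `t` is a coordinate of `𝒜_I` if it induces an isomorphism of `𝒜_I` onto
some annulus `𝒜_J`, that is, if there is an isomorphism `𝒪(𝒜_J) ≃ 𝒪(𝒜_I)`, `T ↦ t`, under which
the points of `𝒜_I` and of `𝒜_J` correspond to each other. (The correspondence of the points makes
the isomorphism bicontinuous for the Gauss norms, hence it is the pullback of functions under
a unique isomorphism of analytic spaces.) -/
def IsCoordinate (t : AnalyticFunction k I) : Prop :=
  ∃ (J : RadiusInterval) (φ : AnalyticFunction k J ≃ₐ[k] AnalyticFunction k I),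
    φ AnalyticFunction.T = t ∧
    (∀ x : BerkovichAnnulus k I, ∃ y : BerkovichAnnulus k J, ∀ f, absAt y f = absAt x (φ f)) ∧
    (∀ y : BerkovichAnnulus k J, ∃ x : BerkovichAnnulus k I, ∀ f, absAt y f = absAt x (φ f))

variable (k I)

/-- The module `Ω¹(𝒜_I)` of differential forms, free of rank one on `dT`; the element `g` stands
for the form `g dT`. -/
def DifferentialForm : Type _ := AnalyticFunction k I

instance : AddCommGroup (DifferentialForm k I) :=
  inferInstanceAs (AddCommGroup (AnalyticFunction k I))

instance : Module (AnalyticFunction k I) (DifferentialForm k I) :=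
  inferInstanceAs (Module (AnalyticFunction k I) (AnalyticFunction k I))

instance : Module k (DifferentialForm k I) :=
  inferInstanceAs (Module k (AnalyticFunction k I))

/-- The exterior derivative `d : 𝒪(𝒜_I) → Ω¹(𝒜_I)`, `df = f' dT`. -/
def exteriorD : Derivation k (AnalyticFunction k I) (DifferentialForm k I) where
  toFun f := AnalyticFunction.derivative f
  map_add' f g := by
    refine AnalyticFunction.ext (fun n => ?_)
    exact mul_add _ _ _
  map_smul' c f := by
    refine AnalyticFunction.ext (fun n => ?_)
    exact mul_left_comm _ _ _
  map_one_eq_zero' := by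
    refine AnalyticFunction.ext (fun n => ?_)
    show ((n + 1 : ℤ) : k) * (AnalyticFunction.monomial 0 1 : AnalyticFunction k I).coeff (n + 1) = 0
    rw [AnalyticFunction.coeff_monomial]
    split_ifs with h
    · simp [h]
    · simp
  leibniz' f g := AnalyticFunction.derivative_mul f g

/-- The module of `q`-differentials on `𝒜_I`: the sections of `(Ω¹)^{⊗ q}`. -/
abbrev QDifferential (q : ℕ) : Type _ :=
  TensorPower (AnalyticFunction k I) q (DifferentialForm k I)

variable {k I}

/-- `ξ` has a zero at `x`: its image in the fibre of `(Ω¹)^{⊗ q}` at `x` is zero. -/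
def HasZeroAt {q : ℕ} (ξ : QDifferential k I q) (x : BerkovichAnnulus k I) : Prop :=
  ξ ∈ vanishingIdeal x • (⊤ : Submodule (AnalyticFunction k I) (QDifferential k I q))

/-- The `q`-differential `(dt/t)^q`, for an invertible function `t`. -/
def dlogPow (q : ℕ) (t : (AnalyticFunction k I)ˣ) : QDifferential k I q :=
  PiTensorProduct.tprod (AnalyticFunction k I)
    fun _ : Fin q => (↑t⁻¹ : AnalyticFunction k I) • exteriorD k I (t : AnalyticFunction k I)

end Annulus

end

/-!
If `f` has no zero then a single monomial dominates it at every radius: at a radius where two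
monomials are maximal, the roots of the polynomial truncations of `f` would accumulate at a zero.
Since the residue characteristic is zero, the exponential converges on functions of Gauss norm
less than `1` and supplies `q`-th roots, so a `q`-differential without zeros is
`c ^ q * T ^ m * v ^ q * (dT/T) ^ q` with `|v - 1| < 1`.

Write `θ = T d/dT` and look for a coordinate `t = T * exp s`, for which `dt/t = (1 + θ s) dT/T`.
With `e = m / q ≠ 0`, one has to solve `(exp (e s) + a) * (1 + θ s) = v`, where `θ a = -e a`. After
multiplication by `T ^ e` it integrates to `exp σ + a * σ = G`, where `σ = e s` and
`θ G + e G = e (v - a)`; the former is solved by a contraction, the latter coefficientwise by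
dividing by `i + e`. These divisors all have absolute value `1`, except when `i = -m / q` is an
integer: `a` removes that coefficient from `v` and becomes the constant `c₀`. For `m = 0` the
coefficient is absorbed in `c` instead.
-/

noncomputable section

section Ultrametric

variable {E : Type*} [SeminormedAddGroup E] [IsUltrametricDist E] {x y : E}

theorem norm_sub_le_max (x y : E) : ‖x - y‖ ≤ max ‖x‖ ‖y‖ := by
  simpa [sub_eq_add_neg] using IsUltrametricDist.norm_add_le_max x (-y)

theorem norm_sub_eq_left_of_norm_lt (h : ‖y‖ < ‖x‖) : ‖x - y‖ = ‖x‖ := by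
  rw [sub_eq_add_neg, IsUltrametricDist.norm_add_eq_max_of_norm_ne_norm, norm_neg, max_eq_left h.le]
  rw [norm_neg]
  exact h.ne'

theorem norm_sub_eq_right_of_norm_lt (h : ‖x‖ < ‖y‖) : ‖x - y‖ = ‖y‖ := by
  rw [norm_sub_rev, norm_sub_eq_left_of_norm_lt h]

end Ultrametric

section UnitCircle

variable {k : Type*} [NormedField k]

/-- The sequence `a` has a largest norm `M > 0`, attained at `l` first and at `u` last. -/
structure HasExtremes (a : ℤ → k) (l u : ℤ) (M : ℝ) : Prop where
  pos : 0 < M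
  le : ∀ i, ‖a i‖ ≤ M
  left : ‖a l‖ = M
  right : ‖a u‖ = M
  lt_left : ∀ i < l, ‖a i‖ < M
  lt_right : ∀ i > u, ‖a i‖ < M

theorem exists_hasExtremes {b : ℤ → k} (hb : Tendsto b cofinite (𝓝 0)) {i j : ℤ} (hi : b i ≠ 0)
    (hmax : ∀ n, ‖b n‖ ≤ ‖b i‖) (hij : i ≠ j) (hj : ‖b j‖ = ‖b i‖) :
    ∃ l u, l < u ∧ HasExtremes b l u ‖b i‖ := by
  have hfin : {n : ℤ | ¬ ‖b n‖ < ‖b i‖}.Finite := eventually_cofinite.1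
    ((tendsto_zero_iff_norm_tendsto_zero.1 hb).eventually_lt_const (norm_pos_iff.2 hi))
  set F := hfin.toFinset
  have mem_F : ∀ n, n ∈ F ↔ ¬ ‖b n‖ < ‖b i‖ := fun n => hfin.mem_toFinset
  have hiF : i ∈ F := (mem_F i).2 (lt_irrefl _)
  have hjF : j ∈ F := (mem_F j).2 hj.not_lt
  have norm_eq : ∀ n ∈ F, ‖b n‖ = ‖b i‖ := fun n hn => (hmax n).antisymm (not_lt.1 ((mem_F n).1 hn))
  have hF : F.Nonempty := ⟨i, hiF⟩
  refine ⟨F.min' hF, F.max' hF, F.min'_lt_max' hiF hjF hij, norm_pos_iff.2 hi, hmax,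
    norm_eq _ (F.min'_mem hF), norm_eq _ (F.max'_mem hF), fun n hn => ?_, fun n hn => ?_⟩
  · by_contra hcon
    exact (F.min'_le n ((mem_F n).2 hcon)).not_gt hn
  · by_contra hcon
    exact (F.le_max' n ((mem_F n).2 hcon)).not_gt hn

namespace HasExtremes

variable {a : ℤ → k} {l u : ℤ} {M : ℝ}

theorem left_le_right (h : HasExtremes a l u M) : l ≤ u :=
  not_lt.1 fun hlt => (h.lt_left _ hlt).ne h.right

theorem unique (h : HasExtremes a l u M) {l' u' : ℤ} {M' : ℝ} (h' : HasExtremes a l' u' M') :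
    l = l' ∧ u = u' ∧ M = M' := by
  obtain rfl : M = M' := le_antisymm (h.left ▸ h'.le l) (h'.left ▸ h.le l')
  refine ⟨le_antisymm ?_ ?_, le_antisymm ?_ ?_, rfl⟩
  · exact not_lt.1 fun hlt => (h.lt_left _ hlt).ne h'.left
  · exact not_lt.1 fun hlt => (h'.lt_left _ hlt).ne h.left
  · exact not_lt.1 fun hlt => (h'.lt_right _ hlt).ne h.right
  · exact not_lt.1 fun hlt => (h.lt_right _ hlt).ne h'.right

theorem const_mul (h : HasExtremes a l u M) {c : k} (hc : c ≠ 0) :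
    HasExtremes (fun i => c * a i) l u (‖c‖ * M) := by
  have hc' := norm_pos_iff.2 hc
  refine ⟨mul_pos hc' h.pos, fun i => ?_, ?_, ?_, fun i hi => ?_, fun i hi => ?_⟩ <;>
    rw [norm_mul]
  · exact mul_le_mul_of_nonneg_left (h.le i) hc'.le
  · rw [h.left]
  · rw [h.right]
  · exact mul_lt_mul_of_pos_left (h.lt_left i hi) hc'
  · exact mul_lt_mul_of_pos_left (h.lt_right i hi) hc'

variable [IsUltrametricDist k]

theorem mul_linear_of_lt (h : HasExtremes a l u M) {β : k} (hβ : ‖β‖ < 1) :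
    HasExtremes (fun i => a (i - 1) - β * a i) (l + 1) (u + 1) M := by
  have hb : ∀ i, ‖β * a i‖ < M := fun i => by
    rw [norm_mul]
    exact (mul_le_mul_of_nonneg_left (h.le i) (norm_nonneg β)).trans_lt
      (mul_lt_of_lt_one_left h.pos hβ)
  refine ⟨h.pos, fun i => ?_, ?_, ?_, fun i hi => ?_, fun i hi => ?_⟩
  · exact (norm_sub_le_max _ _).trans (max_le (h.le _) (hb i).le)
  · rw [add_sub_cancel_right, norm_sub_eq_left_of_norm_lt (by rw [h.left]; exact hb _), h.left]
  · rw [add_sub_cancel_right, norm_sub_eq_left_of_norm_lt (by rw [h.right]; exact hb _), h.right]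
  · exact (norm_sub_le_max _ _).trans_lt
      (max_lt (h.lt_left _ (by omega)) (hb i))
  · exact (norm_sub_le_max _ _).trans_lt
      (max_lt (h.lt_right _ (by omega)) (hb i))

theorem mul_linear_of_gt (h : HasExtremes a l u M) {β : k} (hβ : 1 < ‖β‖) :
    HasExtremes (fun i => a (i - 1) - β * a i) l u (‖β‖ * M) := by
  have hβ0 : 0 < ‖β‖ := one_pos.trans hβ
  have ha : ∀ i, ‖a i‖ < ‖β‖ * M := fun i => (h.le i).trans_lt (lt_mul_of_one_lt_left h.pos hβ)
  refine ⟨mul_pos hβ0 h.pos, fun i => ?_, ?_, ?_, fun i hi => ?_, fun i hi => ?_⟩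
  · refine (norm_sub_le_max _ _).trans (max_le (ha _).le ?_)
    rw [norm_mul]
    exact mul_le_mul_of_nonneg_left (h.le i) hβ0.le
  · rw [norm_sub_eq_right_of_norm_lt (by rw [norm_mul, h.left]; exact ha _), norm_mul, h.left]
  · rw [norm_sub_eq_right_of_norm_lt (by rw [norm_mul, h.right]; exact ha _), norm_mul, h.right]
  · refine (norm_sub_le_max _ _).trans_lt (max_lt (ha _) ?_)
    rw [norm_mul]
    exact mul_lt_mul_of_pos_left (h.lt_left _ hi) hβ0
  · refine (norm_sub_le_max _ _).trans_lt (max_lt (ha _) ?_)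
    rw [norm_mul]
    exact mul_lt_mul_of_pos_left (h.lt_right _ hi) hβ0

theorem mul_linear_of_eq (h : HasExtremes a l u M) {β : k} (hβ : ‖β‖ = 1) :
    HasExtremes (fun i => a (i - 1) - β * a i) l (u + 1) M := by
  have := h.left_le_right
  have hb : ∀ i, ‖β * a i‖ = ‖a i‖ := fun i => by rw [norm_mul, hβ, one_mul]
  refine ⟨h.pos, fun i => ?_, ?_, ?_, fun i hi => ?_, fun i hi => ?_⟩
  · exact (norm_sub_le_max _ _).trans (max_le (h.le _) ((hb i).le.trans (h.le i)))
  · rw [norm_sub_eq_right_of_norm_lt, hb, h.left]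
    rw [hb, h.left]
    exact h.lt_left _ (by omega)
  · rw [add_sub_cancel_right, norm_sub_eq_left_of_norm_lt, h.right]
    rw [hb, h.right]
    exact h.lt_right _ (by omega)
  · exact (norm_sub_le_max _ _).trans_lt
      (max_lt (h.lt_left _ (by omega)) ((hb i).trans_lt (h.lt_left _ hi)))
  · exact (norm_sub_le_max _ _).trans_lt
      (max_lt (h.lt_right _ (by omega)) ((hb i).trans_lt (h.lt_right _ (by omega))))

end HasExtremes

open Polynomial

/-- The coefficients of a polynomial, extended by zero to the negative indices. -/
def intCoeff {R : Type*} [Semiring R] (p : R[X]) (i : ℤ) : R :=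
  if 0 ≤ i then p.coeff i.toNat else 0

theorem intCoeff_C_mul {R : Type*} [Semiring R] (p : R[X]) (c : R) :
    intCoeff (C c * p) = fun i => c * intCoeff p i := by
  ext i
  unfold intCoeff
  split_ifs <;> simp

theorem intCoeff_mul_X_sub_C {R : Type*} [CommRing R] (p : R[X]) (β : R) :
    intCoeff (p * (X - C β)) = fun i => intCoeff p (i - 1) - β * intCoeff p i := by
  ext i
  unfold intCoeff
  rcases lt_trichotomy i 0 with h | rfl | h
  · rw [if_neg (by omega), if_neg (by omega), if_neg (by omega), mul_zero, sub_zero]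
  · simp [mul_comm]
  · obtain ⟨n, rfl⟩ : ∃ n : ℕ, i = n + 1 := ⟨(i - 1).toNat, by omega⟩
    rw [if_pos (by omega), if_pos (by omega), if_pos (by omega), add_sub_cancel_right,
      Int.toNat_natCast, Int.toNat_natCast_add_one, coeff_mul_X_sub_C, mul_comm β]

theorem hasExtremes_intCoeff_one : HasExtremes (intCoeff (1 : k[X])) 0 0 1 := by
  have intCoeff_of_ne : ∀ i : ℤ, i ≠ 0 → intCoeff (1 : k[X]) i = 0 := fun i hi => by
    unfold intCoeff
    split_ifs
    · rw [coeff_one, if_neg (by omega)]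
    · rfl
  have norm_zero_lt : ∀ i : ℤ, i ≠ 0 → ‖intCoeff (1 : k[X]) i‖ < 1 := fun i hi => by
    simp [intCoeff_of_ne i hi]
  have norm_eq : ‖intCoeff (1 : k[X]) 0‖ = 1 := by simp [intCoeff]
  refine ⟨one_pos, fun i => ?_, norm_eq, norm_eq, fun i hi => norm_zero_lt i hi.ne,
    fun i hi => norm_zero_lt i hi.ne'⟩
  rcases eq_or_ne i 0 with rfl | hi
  · exact norm_eq.le
  · exact (norm_zero_lt i hi).le

open Classical in
/-- The roots of norm one of a polynomial, with multiplicities. -/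
def unitRoots (P : k[X]) : Multiset k := P.roots.filter (‖·‖ = 1)

theorem norm_of_mem_unitRoots {P : k[X]} {α : k} (h : α ∈ unitRoots P) : ‖α‖ = 1 :=
  (Multiset.mem_filter.1 h).2

theorem eval_of_mem_unitRoots {P : k[X]} {α : k} (h : α ∈ unitRoots P) : P.eval α = 0 :=
  (mem_roots'.1 (Multiset.mem_filter.1 h).1).2

section UnitRoots

variable [IsUltrametricDist k]

open Classical in
/-- The slope-zero segment of the Newton polygon. -/
theorem exists_hasExtremes_prod_X_sub_C (S : Multiset k) :
    ∃ l M, HasExtremes (intCoeff (S.map (X - C ·)).prod) l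
        (l + (S.filter (‖·‖ = 1)).card) M ∧
      ∀ z : k, ‖z‖ = 1 → ‖((S.map (X - C ·)).prod).eval z‖ =
        M * ((S.filter (‖·‖ = 1)).map (‖z - ·‖)).prod := by
  induction S using Multiset.induction_on with
  | empty => exact ⟨0, 1, by simpa using hasExtremes_intCoeff_one, by simp⟩
  | cons β S ih =>
    obtain ⟨l, M, hM, norm_eval⟩ := ih
    simp only [Multiset.map_cons, Multiset.prod_cons, mul_comm (X - C β), intCoeff_mul_X_sub_C,
      eval_mul, norm_mul, eval_sub, eval_X, eval_C]
    rcases lt_trichotomy ‖β‖ 1 with h | h | h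
    · rw [Multiset.filter_cons_of_neg (p := (‖·‖ = 1)) _ h.ne]
      refine ⟨l + 1, M, ?_, fun z hz => ?_⟩
      · rw [add_right_comm]
        exact hM.mul_linear_of_lt h
      · rw [norm_eval z hz, norm_sub_eq_left_of_norm_lt (by rwa [hz]), hz, mul_one]
    · rw [Multiset.filter_cons_of_pos (p := (‖·‖ = 1)) _ h, Multiset.card_cons, Nat.cast_add_one]
      refine ⟨l, M, add_assoc l _ 1 ▸ hM.mul_linear_of_eq h, fun z hz => ?_⟩
      rw [norm_eval z hz, Multiset.map_cons, Multiset.prod_cons, mul_right_comm, mul_assoc]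
    · rw [Multiset.filter_cons_of_neg (p := (‖·‖ = 1)) _ h.ne']
      refine ⟨l, ‖β‖ * M, hM.mul_linear_of_gt h, fun z hz => ?_⟩
      rw [norm_eval z hz, norm_sub_eq_right_of_norm_lt (by rwa [hz]), mul_right_comm, mul_comm M]

variable [IsAlgClosed k] {P : k[X]} {l u : ℤ} {M : ℝ}

theorem HasExtremes.card_unitRoots_and_norm_eval (hP : HasExtremes (intCoeff P) l u M) :
    u = l + (unitRoots P).card ∧
      ∀ z : k, ‖z‖ = 1 → ‖P.eval z‖ = M * ((unitRoots P).map (‖z - ·‖)).prod := by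
  have hc : P.leadingCoeff ≠ 0 := by
    rw [leadingCoeff_ne_zero]
    rintro rfl
    exact hP.pos.ne (by simpa [intCoeff] using hP.left)
  obtain ⟨l', M', hM', norm_eval⟩ := exists_hasExtremes_prod_X_sub_C P.roots
  have eq_prod := (IsAlgClosed.splits P).eq_prod_roots
  have hP' := hM'.const_mul hc
  rw [← intCoeff_C_mul, ← eq_prod] at hP'
  obtain ⟨rfl, hu, rfl⟩ := hP.unique hP'
  refine ⟨hu, fun z hz => ?_⟩
  rw [eq_prod, eval_mul, norm_mul, norm_eval z hz, eval_C, mul_assoc, ← eq_prod, unitRoots]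

theorem exists_mem_unitRoots_norm_pow_le (hP : HasExtremes (intCoeff P) l u M) (hlu : l < u)
    {z : k} (hz : ‖z‖ = 1) :
    ∃ β ∈ unitRoots P, M * ‖z - β‖ ^ (u - l).toNat ≤ ‖P.eval z‖ := by
  classical
  obtain ⟨hcard, norm_eval⟩ := hP.card_unitRoots_and_norm_eval
  obtain ⟨β, hβ, hmin⟩ := (unitRoots P).toFinset.exists_min_image (‖z - ·‖) <| by
    rw [Multiset.toFinset_nonempty, ← Multiset.card_pos]
    omega
  refine ⟨β, Multiset.mem_toFinset.1 hβ, ?_⟩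
  have pow_le := Multiset.prod_map_le_prod_map₀ (s := unitRoots P) (fun _ => ‖z - β‖) (‖z - ·‖)
    (fun _ _ => norm_nonneg _) (fun γ hγ => hmin γ (Multiset.mem_toFinset.2 hγ))
  rw [Multiset.map_const', Multiset.prod_replicate] at pow_le
  rw [norm_eval z hz, show (u - l).toNat = (unitRoots P).card by omega]
  exact mul_le_mul_of_nonneg_left pow_le hP.pos.le

theorem norm_eval_le_of_mem_unitRoots (hP : HasExtremes (intCoeff P) l u M) {z α : k}
    (hz : ‖z‖ = 1) (hα : α ∈ unitRoots P) : ‖P.eval z‖ ≤ M * ‖z - α‖ := by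
  rw [hP.card_unitRoots_and_norm_eval.2 z hz]
  have norm_eq : ∀ β ∈ unitRoots P, ‖β‖ = 1 := fun _ => norm_of_mem_unitRoots
  obtain ⟨t, ht⟩ := Multiset.exists_cons_of_mem hα
  rw [ht, Multiset.map_cons, Multiset.prod_cons]
  refine mul_le_mul_of_nonneg_left (mul_le_of_le_one_right (norm_nonneg _) ?_) hP.pos.le
  have prod_le := Multiset.prod_map_le_prod_map₀ (s := t) (‖z - ·‖) (fun _ => (1 : ℝ))
    (fun _ _ => norm_nonneg _) (fun γ hγ => (norm_sub_le_max z γ).trans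
      (by rw [hz, norm_eq γ (ht ▸ Multiset.mem_cons_of_mem hγ), max_self]))
  simpa using prod_le

end UnitRoots

/-- The truncation `∑_{|i| ≤ N} bᵢ Xⁱ⁺ᴺ` of the two-sided series `∑ bᵢ Xⁱ`, multiplied by `Xᴺ` to
become a polynomial. -/
def truncPoly {R : Type*} [Semiring R] (b : ℤ → R) (N : ℕ) : R[X] :=
  ∑ j ∈ Finset.range (2 * N + 1), C (b (j - N)) * X ^ j

theorem intCoeff_truncPoly {R : Type*} [Semiring R] (b : ℤ → R) (N : ℕ) (i : ℤ) :
    intCoeff (truncPoly b N) i = if |i - N| ≤ N then b (i - N) else 0 := by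
  unfold intCoeff truncPoly
  simp only [abs_le, finsetSum_coeff, coeff_C_mul, coeff_X_pow, mul_ite, mul_one, mul_zero,
    Finset.sum_ite_eq, Finset.mem_range]
  split_ifs <;> first | omega | rfl | (congr 1; omega)

theorem HasExtremes.truncPoly {b : ℤ → k} {l u : ℤ} {M : ℝ} (h : HasExtremes b l u M) {N : ℕ}
    (hl : -(N : ℤ) ≤ l) (hu : u ≤ N) :
    HasExtremes (intCoeff (truncPoly b N)) (l + N) (u + N) M := by
  have := h.left_le_right
  refine ⟨h.pos, fun i => ?_, ?_, ?_, fun i hi => ?_, fun i hi => ?_⟩ <;>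
    simp only [intCoeff_truncPoly, abs_le, add_sub_cancel_right]
  · split_ifs
    · exact h.le _
    · simpa using h.pos.le
  · rw [if_pos (by omega), h.left]
  · rw [if_pos (by omega), h.right]
  · split_ifs
    · exact h.lt_left _ (by omega)
    · simpa using h.pos
  · split_ifs
    · exact h.lt_right _ (by omega)
    · simpa using h.pos

theorem truncPoly_succ {R : Type*} [CommSemiring R] (b : ℤ → R) (N : ℕ) :
    truncPoly b (N + 1) =
      X * truncPoly b N + (C (b (-(N + 1))) + C (b (N + 1)) * X ^ (2 * N + 2)) := by
  unfold truncPoly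
  rw [show 2 * (N + 1) + 1 = (2 * N + 1 + 1) + 1 by ring, Finset.sum_range_succ,
    Finset.sum_range_succ', Finset.mul_sum, add_assoc]
  congr 1
  · refine Finset.sum_congr rfl fun j _ => ?_
    rw [Nat.cast_succ, Nat.cast_succ, add_sub_add_right_eq_sub, pow_succ]
    ring
  · congr 3 <;> push_cast <;> ring_nf

theorem eval_truncPoly (b : ℤ → k) (N : ℕ) {z : k} (hz : z ≠ 0) :
    (truncPoly b N).eval z = z ^ N * ∑ i ∈ Finset.Icc (-(N : ℤ)) N, b i * z ^ i := by
  simp only [truncPoly, eval_finsetSum, eval_mul, eval_C, eval_pow, eval_X, Finset.mul_sum]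
  refine Finset.sum_bij' (fun j _ => (j : ℤ) - N) (fun i _ => (i + N).toNat) ?_ ?_ ?_ ?_ ?_
  · intro j hj
    rw [Finset.mem_range] at hj
    rw [Finset.mem_Icc]
    omega
  · intro i hi
    rw [Finset.mem_Icc] at hi
    rw [Finset.mem_range]
    omega
  · intro j _
    simp
  · intro i hi
    rw [Finset.mem_Icc] at hi
    omega
  · intro j _
    rw [mul_left_comm, ← zpow_natCast z N, ← zpow_add₀ hz, add_sub_cancel, zpow_natCast]

section Zeros

variable [IsUltrametricDist k] [IsAlgClosed k] {b : ℤ → k} {l u : ℤ} {M : ℝ}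

theorem HasExtremes.exists_mem_unitRoots_truncPoly_succ (h : HasExtremes b l u M) (hlu : l < u)
    {N : ℕ} (hl : -(N : ℤ) ≤ l) (hu : u ≤ N) {α : k} (hα : α ∈ unitRoots (_root_.truncPoly b N)) :
    ∃ β ∈ unitRoots (_root_.truncPoly b (N + 1)),
      M * ‖β - α‖ ^ (u - l).toNat ≤ max ‖b (-(N + 1))‖ ‖b (N + 1)‖ := by
  have norm_α := norm_of_mem_unitRoots hα
  have hext := h.truncPoly (N := N + 1) (by omega) (by omega)
  obtain ⟨β, hβ, hle⟩ := exists_mem_unitRoots_norm_pow_le hext (by omega) norm_α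
  refine ⟨β, hβ, ?_⟩
  rw [add_sub_add_right_eq_sub, norm_sub_rev] at hle
  refine hle.trans ?_
  simp only [truncPoly_succ, eval_add, eval_mul, eval_X, eval_of_mem_unitRoots hα, mul_zero,
    zero_add, eval_C, eval_pow]
  refine (IsUltrametricDist.norm_add_le_max _ _).trans_eq ?_
  rw [norm_mul, norm_pow, norm_α, one_pow, mul_one]

theorem HasExtremes.exists_cauchySeq_unitRoots (h : HasExtremes b l u M) (hlu : l < u) {N : ℕ}
    (hl : -(N : ℤ) ≤ l) (hu : u ≤ N) (hb : Tendsto b cofinite (𝓝 0)) :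
    ∃ α : ℕ → k, CauchySeq α ∧ ∀ n, α n ∈ unitRoots (_root_.truncPoly b (N + n)) := by
  set d := (u - l).toNat
  obtain ⟨α₀, hα₀, -⟩ := exists_mem_unitRoots_norm_pow_le (h.truncPoly hl hu)
    (by omega) norm_one
  choose! next next_mem next_close using fun (n : ℕ) (α : k) =>
    h.exists_mem_unitRoots_truncPoly_succ hlu (N := N + n) (by omega) (by omega) (α := α)
  let α : ℕ → k := fun n => Nat.rec α₀ next n
  have α_mem : ∀ n, α n ∈ unitRoots (_root_.truncPoly b (N + n)) := fun n => by
    induction n with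
    | zero => exact hα₀
    | succ n ih => exact next_mem n _ ih
  refine ⟨α, NonarchimedeanAddGroup.cauchySeq_of_tendsto_sub_nhds_zero ?_, α_mem⟩
  have tendsto_bound : Tendsto (fun n : ℕ => max ‖b (-((N + n : ℕ) + 1))‖ ‖b ((N + n : ℕ) + 1)‖)
      atTop (𝓝 0) := by
    have tendsto_norm_b := tendsto_zero_iff_norm_tendsto_zero.1 hb
    rw [← Nat.cofinite_eq_atTop, ← max_self (0 : ℝ)]
    refine .max (tendsto_norm_b.comp (Function.Injective.tendsto_cofinite fun m n hmn => ?_))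
      (tendsto_norm_b.comp (Function.Injective.tendsto_cofinite fun m n hmn => ?_))
    all_goals omega
  rw [Metric.tendsto_nhds]
  intro δ hδ
  filter_upwards [tendsto_bound.eventually_lt_const (mul_pos h.pos (pow_pos hδ d))] with n hn
  rw [dist_zero_right]
  refine lt_of_pow_lt_pow_left₀ d hδ.le ?_
  exact lt_of_mul_lt_mul_left ((next_close n _ (α_mem n)).trans_lt hn) h.pos.le

theorem HasExtremes.exists_zero [CompleteSpace k] (h : HasExtremes b l u M) (hlu : l < u)
    (hb : Tendsto b cofinite (𝓝 0)) : ∃ z : k, ‖z‖ = 1 ∧ HasSum (fun i => b i * z ^ i) 0 := by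
  set N := max l.natAbs u.natAbs
  obtain ⟨α, cauchy_α, hα⟩ :=
    h.exists_cauchySeq_unitRoots hlu (N := N) (by omega) (by omega) hb
  obtain ⟨z, tendsto_α⟩ := cauchySeq_tendsto_of_complete cauchy_α
  have norm_z : ‖z‖ = 1 := tendsto_nhds_unique tendsto_α.norm
    (tendsto_const_nhds.congr fun n => (norm_of_mem_unitRoots (hα n)).symm)
  have z_ne : z ≠ 0 := norm_ne_zero_iff.1 (norm_z ▸ one_ne_zero)
  have summable_z : Summable fun i => b i * z ^ i := by
    refine NonarchimedeanAddGroup.summable_of_tendsto_cofinite_zero ?_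
    rw [tendsto_zero_iff_norm_tendsto_zero] at hb ⊢
    simpa [norm_z] using hb
  have tendsto_tsum : Tendsto (fun n : ℕ => ∑ i ∈ Finset.Icc (-((N + n : ℕ) : ℤ)) (N + n : ℕ),
      b i * z ^ i) atTop (𝓝 (∑' i, b i * z ^ i)) :=
    (summable_z.hasSum.comp Finset.tendsto_Icc_neg).comp
      (tendsto_atTop_mono (fun n => Nat.le_add_left n N) tendsto_id)
  have tendsto_zero : Tendsto (fun n : ℕ => ∑ i ∈ Finset.Icc (-((N + n : ℕ) : ℤ)) (N + n : ℕ),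
      b i * z ^ i) atTop (𝓝 0) := by
    refine squeeze_zero_norm (a := fun n => M * ‖z - α n‖) (fun n => ?_) <| by
      simpa using (tendsto_α.const_sub z).norm.const_mul M
    have norm_eval_le := norm_eval_le_of_mem_unitRoots
      (h.truncPoly (N := N + n) (by omega) (by omega)) norm_z (hα n)
    rwa [eval_truncPoly b _ z_ne, norm_mul, norm_pow, norm_z, one_pow, one_mul] at norm_eval_le
  exact ⟨z, norm_z, tendsto_nhds_unique tendsto_tsum tendsto_zero ▸ summable_z.hasSum⟩

end Zeros

end UnitCircle

section ResidueCharacteristic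

variable {k : Type*} [NormedField k] [IsUltrametricDist k]
  [CharZero (IsLocalRing.ResidueField (NormedField.valuation (K := k)).valuationSubring)]

theorem norm_natCast_eq_one_of_charZero_residueField {n : ℕ} (hn : n ≠ 0) : ‖(n : k)‖ = 1 := by
  let v := NormedField.valuation (K := k)
  have residue_ne_zero : IsLocalRing.residue v.valuationSubring n ≠ 0 := by
    rwa [map_natCast, Nat.cast_ne_zero]
  have isUnit_n : IsUnit (n : v.valuationSubring) :=
    (IsLocalRing.residue_ne_zero_iff_isUnit _).1 residue_ne_zero
  have val_n : v (n : k) = 1 := by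
    simpa using (Valuation.valuationSubring.integers v).isUnit_iff_valuation_eq_one.1 isUnit_n
  rw [NormedField.valuation_apply] at val_n
  exact congrArg NNReal.toReal val_n

theorem norm_intCast_eq_one_of_charZero_residueField {n : ℤ} (hn : n ≠ 0) : ‖(n : k)‖ = 1 := by
  obtain ⟨m, rfl | rfl⟩ := n.eq_nat_or_neg
  · simpa using norm_natCast_eq_one_of_charZero_residueField (k := k) (by simpa using hn)
  · simpa using norm_natCast_eq_one_of_charZero_residueField (k := k) (by simpa using hn)

variable (k) in
theorem charZero_of_charZero_residueField : CharZero k :=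
  charZero_of_inj_zero fun n hn => by
    by_contra h
    simpa [hn] using norm_natCast_eq_one_of_charZero_residueField (k := k) h

end ResidueCharacteristic

theorem exists_norm_eq_of_norm_eq_zpow {k : Type*} [NormedField k] [IsAlgClosed k] {c : k} {ρ : ℝ}
    (hρ : 0 < ρ) {n : ℤ} (hn : n ≠ 0) (h : ‖c‖ = ρ ^ n) : ∃ α : k, ‖α‖ = ρ := by
  obtain ⟨m, rfl | rfl⟩ := n.eq_nat_or_neg
  · obtain ⟨α, hα⟩ := IsAlgClosed.exists_pow_nat_eq c (n := m) (by omega)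
    refine ⟨α, (pow_left_inj₀ (norm_nonneg α) hρ.le (by omega : m ≠ 0)).1 ?_⟩
    rw [← norm_pow, hα, h, zpow_natCast]
  · obtain ⟨α, hα⟩ := IsAlgClosed.exists_pow_nat_eq c⁻¹ (n := m) (by omega)
    refine ⟨α, (pow_left_inj₀ (norm_nonneg α) hρ.le (by omega : m ≠ 0)).1 ?_⟩
    rw [← norm_pow, hα, norm_inv, h, zpow_neg, inv_inv, zpow_natCast]

theorem RadiusInterval.ordConnected_carrier (I : RadiusInterval) : I.carrier.OrdConnected := by
  obtain ⟨r, R, _, _, h | h | h | h⟩ := I.shape <;> rw [h]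
  · exact Set.ordConnected_Icc
  · exact Set.ordConnected_Ioo
  · exact Set.ordConnected_Ico
  · exact Set.ordConnected_Ioc

namespace AnalyticFunction

section GaussNorm

variable {k : Type*} [NormedField k] {I : RadiusInterval}

@[simp]
theorem coeff_neg (f : AnalyticFunction k I) (i : ℤ) : (-f).coeff i = -f.coeff i := rfl

@[simp]
theorem coeff_sub (f g : AnalyticFunction k I) (i : ℤ) :
    (f - g).coeff i = f.coeff i - g.coeff i := rfl

theorem norm_coeff_mul_zpow_nonneg (f : AnalyticFunction k I) {ρ : ℝ} (hρ : ρ ∈ I) (i : ℤ) :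
    0 ≤ ‖f.coeff i‖ * ρ ^ i :=
  mul_nonneg (norm_nonneg _) (zpow_nonneg (I.pos ρ hρ).le i)

theorem norm_coeff_mul_zpow_le_gaussNorm (f : AnalyticFunction k I) {ρ : ℝ} (hρ : ρ ∈ I) (i : ℤ) :
    ‖f.coeff i‖ * ρ ^ i ≤ f.gaussNorm ρ :=
  le_ciSup (f.tendsto_coeff hρ).bddAbove_range_of_cofinite i

theorem gaussNorm_le {f : AnalyticFunction k I} {ρ C : ℝ} (h : ∀ i, ‖f.coeff i‖ * ρ ^ i ≤ C) :
    f.gaussNorm ρ ≤ C :=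
  ciSup_le h

theorem gaussNorm_nonneg (f : AnalyticFunction k I) {ρ : ℝ} (hρ : ρ ∈ I) : 0 ≤ f.gaussNorm ρ :=
  (f.norm_coeff_mul_zpow_nonneg hρ 0).trans (f.norm_coeff_mul_zpow_le_gaussNorm hρ 0)

@[simp]
theorem gaussNorm_zero (ρ : ℝ) : (0 : AnalyticFunction k I).gaussNorm ρ = 0 := by
  simp [gaussNorm]

@[simp]
theorem gaussNorm_neg (ρ : ℝ) (f : AnalyticFunction k I) : (-f).gaussNorm ρ = f.gaussNorm ρ := by
  simp [gaussNorm]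

theorem gaussNorm_pos {f : AnalyticFunction k I} (hf : f ≠ 0) {ρ : ℝ} (hρ : ρ ∈ I) :
    0 < f.gaussNorm ρ := by
  obtain ⟨i, hi⟩ : ∃ i, f.coeff i ≠ 0 := by
    by_contra! h
    exact hf (ext h)
  exact (mul_pos (norm_pos_iff.2 hi) (zpow_pos (I.pos ρ hρ) i)).trans_le
    (f.norm_coeff_mul_zpow_le_gaussNorm hρ i)

theorem exists_norm_coeff_mul_zpow_eq_gaussNorm (f : AnalyticFunction k I) {ρ : ℝ} (hρ : ρ ∈ I) :
    ∃ i, ‖f.coeff i‖ * ρ ^ i = f.gaussNorm ρ := by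
  by_cases hf : f = 0
  · simp [hf]
  have exists_half_lt : ∃ j, f.gaussNorm ρ / 2 < ‖f.coeff j‖ * ρ ^ j :=
    exists_lt_of_lt_ciSup (half_lt_self (gaussNorm_pos hf hρ))
  obtain ⟨j, hj⟩ := exists_half_lt
  have eventually_le : ∀ᶠ i in cocompact ℤ, ‖f.coeff i‖ * ρ ^ i ≤ ‖f.coeff j‖ * ρ ^ j := by
    rw [cocompact_eq_cofinite]
    exact (f.tendsto_coeff hρ).eventually_le_const ((half_pos (gaussNorm_pos hf hρ)).trans hj)
  obtain ⟨i, hi⟩ := continuous_of_discreteTopology.exists_forall_ge' j eventually_le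
  exact ⟨i, (f.norm_coeff_mul_zpow_le_gaussNorm hρ i).antisymm (gaussNorm_le hi)⟩

theorem gaussNorm_lt {f : AnalyticFunction k I} {ρ C : ℝ} (hρ : ρ ∈ I)
    (h : ∀ i, ‖f.coeff i‖ * ρ ^ i < C) : f.gaussNorm ρ < C := by
  obtain ⟨i, hi⟩ := f.exists_norm_coeff_mul_zpow_eq_gaussNorm hρ
  exact hi ▸ h i

theorem gaussNorm_smul_le (c : k) (f : AnalyticFunction k I) {ρ : ℝ} (hρ : ρ ∈ I) :
    (c • f).gaussNorm ρ ≤ ‖c‖ * f.gaussNorm ρ := by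
  refine gaussNorm_le fun i => ?_
  rw [coeff_smul, norm_mul, mul_assoc]
  exact mul_le_mul_of_nonneg_left (f.norm_coeff_mul_zpow_le_gaussNorm hρ i) (norm_nonneg _)

theorem gaussNorm_monomial_le (n : ℤ) (c : k) {ρ : ℝ} (hρ : ρ ∈ I) :
    (monomial n c : AnalyticFunction k I).gaussNorm ρ ≤ ‖c‖ * ρ ^ n := by
  refine gaussNorm_le fun i => ?_
  rw [coeff_monomial]
  split_ifs with h
  · rw [h]
  · simpa using mul_nonneg (norm_nonneg c) (zpow_nonneg (I.pos ρ hρ).le n)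

theorem gaussNorm_one_le {ρ : ℝ} (hρ : ρ ∈ I) : (1 : AnalyticFunction k I).gaussNorm ρ ≤ 1 :=
  (gaussNorm_monomial_le 0 1 hρ).trans_eq (by simp)

variable [IsUltrametricDist k]

theorem gaussNorm_add_le (f g : AnalyticFunction k I) {ρ : ℝ} (hρ : ρ ∈ I) :
    (f + g).gaussNorm ρ ≤ max (f.gaussNorm ρ) (g.gaussNorm ρ) := by
  refine gaussNorm_le fun i => ?_
  have zpow_nonneg := zpow_nonneg (I.pos ρ hρ).le i
  calc ‖f.coeff i + g.coeff i‖ * ρ ^ i ≤ max ‖f.coeff i‖ ‖g.coeff i‖ * ρ ^ i :=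
        mul_le_mul_of_nonneg_right (IsUltrametricDist.norm_add_le_max _ _) zpow_nonneg
    _ = max (‖f.coeff i‖ * ρ ^ i) (‖g.coeff i‖ * ρ ^ i) := max_mul_of_nonneg _ _ zpow_nonneg
    _ ≤ max (f.gaussNorm ρ) (g.gaussNorm ρ) := max_le_max
        (f.norm_coeff_mul_zpow_le_gaussNorm hρ i) (g.norm_coeff_mul_zpow_le_gaussNorm hρ i)

theorem gaussNorm_sub_le (f g : AnalyticFunction k I) {ρ : ℝ} (hρ : ρ ∈ I) :
    (f - g).gaussNorm ρ ≤ max (f.gaussNorm ρ) (g.gaussNorm ρ) := by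
  simpa [sub_eq_add_neg] using gaussNorm_add_le f (-g) hρ

theorem gaussNorm_sum_le {ι : Type*} (s : Finset ι) {F : ι → AnalyticFunction k I} {ρ C : ℝ}
    (hρ : ρ ∈ I) (hC : 0 ≤ C) (h : ∀ i ∈ s, (F i).gaussNorm ρ ≤ C) :
    (∑ i ∈ s, F i).gaussNorm ρ ≤ C :=
  Finset.sum_induction F (fun f => f.gaussNorm ρ ≤ C)
    (fun f g hf hg => (gaussNorm_add_le f g hρ).trans (max_le hf hg)) (by simpa using hC) h

variable [CompleteSpace k]

theorem gaussNorm_mul_le (f g : AnalyticFunction k I) {ρ : ℝ} (hρ : ρ ∈ I) :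
    (f * g).gaussNorm ρ ≤ f.gaussNorm ρ * g.gaussNorm ρ := by
  refine gaussNorm_le fun n => ?_
  have ρ_pos := I.pos ρ hρ
  have zpow_n_pos := zpow_pos ρ_pos n
  rw [coeff_mul, ← le_div_iff₀ zpow_n_pos]
  refine norm_tsum_le_of_forall_le
    (div_nonneg (mul_nonneg (gaussNorm_nonneg f hρ) (gaussNorm_nonneg g hρ)) zpow_n_pos.le)
    fun i => ?_
  have zpow_n : ρ ^ n = ρ ^ i * ρ ^ (n - i) := by rw [← zpow_add₀ ρ_pos.ne', add_sub_cancel]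
  rw [le_div_iff₀ zpow_n_pos, norm_mul]
  calc ‖f.coeff i‖ * ‖g.coeff (n - i)‖ * ρ ^ n
      = (‖f.coeff i‖ * ρ ^ i) * (‖g.coeff (n - i)‖ * ρ ^ (n - i)) := by rw [zpow_n]; ring
    _ ≤ f.gaussNorm ρ * g.gaussNorm ρ := mul_le_mul (f.norm_coeff_mul_zpow_le_gaussNorm hρ i)
        (g.norm_coeff_mul_zpow_le_gaussNorm hρ _) (g.norm_coeff_mul_zpow_nonneg hρ _)
        (gaussNorm_nonneg f hρ)

theorem gaussNorm_pow_le (f : AnalyticFunction k I) {ρ : ℝ} (hρ : ρ ∈ I) (n : ℕ) :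
    (f ^ n).gaussNorm ρ ≤ f.gaussNorm ρ ^ n := by
  induction n with
  | zero => simpa using gaussNorm_one_le hρ
  | succ n ih =>
    rw [pow_succ, pow_succ]
    exact (gaussNorm_mul_le _ _ hρ).trans (mul_le_mul_of_nonneg_right ih (gaussNorm_nonneg f hρ))

theorem monomial_mul_monomial (m n : ℤ) (c d : k) :
    (monomial m c * monomial n d : AnalyticFunction k I) = monomial (m + n) (c * d) := by
  ext i
  simp [coeff_monomial_mul, coeff_monomial, sub_eq_iff_eq_add']

theorem algebraMap_eq_monomial (c : k) : algebraMap k (AnalyticFunction k I) c = monomial 0 c := by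
  ext i
  simp [Algebra.algebraMap_eq_smul_one, one_def, coeff_monomial]

/-- The standard coordinate `T` as a unit. -/
def unitT : (AnalyticFunction k I)ˣ where
  val := T
  inv := monomial (-1) 1
  val_inv := by simp [T, monomial_mul_monomial, one_def]
  inv_val := by simp [T, monomial_mul_monomial, one_def]

theorem val_unitT_zpow (n : ℤ) :
    ((unitT ^ n : (AnalyticFunction k I)ˣ) : AnalyticFunction k I) = monomial n 1 := by
  induction n using Int.induction_on with
  | zero => simp [one_def]
  | succ n ih => rw [zpow_add_one, Units.val_mul, ih]; simp [unitT, T, monomial_mul_monomial]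
  | pred n ih =>
    rw [zpow_sub_one, Units.val_mul, ih]
    simp [unitT, monomial_mul_monomial, sub_eq_add_neg]

end GaussNorm

section Topology

variable {k : Type*} [NormedField k] {I : RadiusInterval} [IsUltrametricDist k]

/-- The subgroups `{f | |f|_ρ ≤ ε for all ρ ∈ s}`, for finite sets `s` of radii; they form
a basis of neighbourhoods of zero for the Fréchet topology of `𝒪(𝒜_I)`. -/
def gaussBall (p : Finset {ρ : ℝ // ρ ∈ I} × {ε : ℝ // 0 < ε}) :
    AddSubgroup (AnalyticFunction k I) where
  carrier := {f | ∀ ρ ∈ p.1, f.gaussNorm ρ ≤ p.2}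
  zero_mem' := fun ρ _ => by simpa using p.2.2.le
  add_mem' := fun {f g} hf hg ρ hρ =>
    (gaussNorm_add_le f g ρ.2).trans (max_le (hf ρ hρ) (hg ρ hρ))
  neg_mem' := fun {f} hf ρ hρ => by simpa using hf ρ hρ

theorem mem_convergentLaurent_of_forall_exists {a : ℤ → k}
    (h : ∀ ρ ∈ I, ∀ ε > 0, ∃ f : AnalyticFunction k I, ∀ n, ‖f.coeff n - a n‖ * ρ ^ n ≤ ε) :
    a ∈ convergentLaurent k I := by
  refine fun ρ hρ => Metric.tendsto_nhds.2 fun ε hε => ?_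
  obtain ⟨f, hf⟩ := h ρ hρ (ε / 2) (half_pos hε)
  filter_upwards [(f.tendsto_coeff hρ).eventually_lt_const hε] with i hi
  have zpow_nonneg := zpow_nonneg (I.pos ρ hρ).le i
  rw [dist_zero_right, Real.norm_of_nonneg (mul_nonneg (norm_nonneg _) zpow_nonneg)]
  calc ‖a i‖ * ρ ^ i ≤ max ‖f.coeff i‖ ‖f.coeff i - a i‖ * ρ ^ i := by
        refine mul_le_mul_of_nonneg_right ?_ zpow_nonneg
        simpa using norm_sub_le_max (f.coeff i) (f.coeff i - a i)
    _ = max (‖f.coeff i‖ * ρ ^ i) (‖f.coeff i - a i‖ * ρ ^ i) := max_mul_of_nonneg _ _ zpow_nonneg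
    _ < ε := max_lt hi ((hf i).trans_lt (half_lt_self hε))

variable [CompleteSpace k]

theorem ringSubgroupsBasis_gaussBall :
    RingSubgroupsBasis (gaussBall : _ → AddSubgroup (AnalyticFunction k I)) := by
  classical
  refine RingSubgroupsBasis.of_comm _ (fun p p' => ?_) (fun p => ?_) fun f p => ?_
  · refine ⟨(p.1 ∪ p'.1, ⟨min p.2 p'.2, lt_min p.2.2 p'.2.2⟩), fun f hf =>
      ⟨fun ρ hρ => ?_, fun ρ hρ => ?_⟩⟩
    · exact (hf ρ (Finset.mem_union_left _ hρ)).trans (min_le_left _ _)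
    · exact (hf ρ (Finset.mem_union_right _ hρ)).trans (min_le_right _ _)
  · refine ⟨(p.1, ⟨min p.2 1, lt_min p.2.2 one_pos⟩), ?_⟩
    rintro _ ⟨f, hf, g, hg, rfl⟩ ρ hρ
    calc (f * g).gaussNorm ρ ≤ f.gaussNorm ρ * g.gaussNorm ρ := gaussNorm_mul_le f g ρ.2
      _ ≤ p.2 * 1 := mul_le_mul ((hf ρ hρ).trans (min_le_left _ _))
          ((hg ρ hρ).trans (min_le_right _ _)) (gaussNorm_nonneg g ρ.2) p.2.2.le
      _ = p.2 := mul_one _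
  · obtain ⟨C, hC⟩ := (p.1.image fun ρ : {ρ : ℝ // ρ ∈ I} => f.gaussNorm ρ).bddAbove
    have gaussNorm_f_le : ∀ ρ ∈ p.1, f.gaussNorm ρ ≤ max C 1 := fun ρ hρ =>
      (hC (Finset.mem_coe.2 (Finset.mem_image_of_mem _ hρ))).trans (le_max_left _ _)
    have max_pos : 0 < max C 1 := lt_max_of_lt_right one_pos
    refine ⟨(p.1, ⟨p.2 / max C 1, div_pos p.2.2 max_pos⟩), fun g hg ρ hρ => ?_⟩
    calc (f * g).gaussNorm ρ ≤ f.gaussNorm ρ * g.gaussNorm ρ := gaussNorm_mul_le f g ρ.2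
      _ ≤ max C 1 * (p.2 / max C 1) :=
          mul_le_mul (gaussNorm_f_le ρ hρ) (hg ρ hρ) (gaussNorm_nonneg g ρ.2) max_pos.le
      _ = p.2 := mul_div_cancel₀ _ max_pos.ne'

instance : Nonempty (Finset {ρ : ℝ // ρ ∈ I} × {ε : ℝ // 0 < ε}) := ⟨(∅, ⟨1, one_pos⟩)⟩

/-- The Fréchet topology defined by the Gauss norms. -/
instance : UniformSpace (AnalyticFunction k I) :=
  (ringSubgroupsBasis_gaussBall (k := k)
    (I := I)).toRingFilterBasis.toAddGroupFilterBasis.uniformSpace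

instance : IsUniformAddGroup (AnalyticFunction k I) :=
  (ringSubgroupsBasis_gaussBall (k := k)
    (I := I)).toRingFilterBasis.toAddGroupFilterBasis.isUniformAddGroup

instance : NonarchimedeanRing (AnalyticFunction k I) :=
  (ringSubgroupsBasis_gaussBall (k := k) (I := I)).nonarchimedean

theorem hasBasis_nhds_zero : (𝓝 (0 : AnalyticFunction k I)).HasBasis (fun _ => True)
    fun p => ((gaussBall p : AddSubgroup (AnalyticFunction k I)) : Set (AnalyticFunction k I)) :=
  (ringSubgroupsBasis_gaussBall (k := k) (I := I)).hasBasis_nhds_zero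

theorem tendsto_zero_iff {ι : Type*} {l : Filter ι} {F : ι → AnalyticFunction k I} :
    Tendsto F l (𝓝 0) ↔ ∀ ρ ∈ I, Tendsto (fun i => (F i).gaussNorm ρ) l (𝓝 0) := by
  rw [hasBasis_nhds_zero.tendsto_right_iff]
  refine ⟨fun h ρ hρ => ?_, fun h p _ => ?_⟩
  · refine Metric.tendsto_nhds.2 fun ε hε => ?_
    filter_upwards [h ({⟨ρ, hρ⟩}, ⟨ε / 2, half_pos hε⟩) trivial] with i hi
    rw [dist_zero_right, Real.norm_of_nonneg (gaussNorm_nonneg _ hρ)]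
    exact (hi ⟨ρ, hρ⟩ (Finset.mem_singleton_self _)).trans_lt (half_lt_self hε)
  · exact (eventually_all_finset p.1).2 fun ρ _ => (h ρ ρ.2).eventually_le_const p.2.2

theorem tendsto_iff {ι : Type*} {l : Filter ι} {F : ι → AnalyticFunction k I}
    {f : AnalyticFunction k I} :
    Tendsto F l (𝓝 f) ↔ ∀ ρ ∈ I, Tendsto (fun i => (F i - f).gaussNorm ρ) l (𝓝 0) := by
  rw [← tendsto_zero_iff, tendsto_sub_nhds_zero_iff]

theorem tendsto_gaussNorm_nhds_zero {ρ : ℝ} (hρ : ρ ∈ I) :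
    Tendsto (fun f : AnalyticFunction k I => f.gaussNorm ρ) (𝓝 0) (𝓝 0) :=
  tendsto_zero_iff.1 tendsto_id ρ hρ

instance : T2Space (AnalyticFunction k I) := by
  refine IsTopologicalAddGroup.t2Space_of_zero_sep fun f hf => ?_
  obtain ⟨ρ, hρ⟩ := I.exists_mem
  exact ⟨{g | g.gaussNorm ρ < f.gaussNorm ρ},
    (tendsto_gaussNorm_nhds_zero hρ).eventually_lt_const (gaussNorm_pos hf hρ),
    lt_irrefl (f.gaussNorm ρ)⟩

theorem continuous_of_norm_le_gaussNorm {F : Type*} [FunLike F (AnalyticFunction k I) k]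
    [AddMonoidHomClass F (AnalyticFunction k I) k] (φ : F) {ρ C : ℝ} (hρ : ρ ∈ I)
    (h : ∀ f, ‖φ f‖ ≤ C * f.gaussNorm ρ) : Continuous φ := by
  refine continuous_of_continuousAt_zero φ ?_
  rw [ContinuousAt, map_zero]
  exact squeeze_zero_norm h (by simpa using (tendsto_gaussNorm_nhds_zero hρ).const_mul C)

theorem continuous_of_gaussNorm_le {F : Type*}
    [FunLike F (AnalyticFunction k I) (AnalyticFunction k I)]
    [AddMonoidHomClass F (AnalyticFunction k I) (AnalyticFunction k I)] (φ : F)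
    (h : ∀ ρ ∈ I, ∀ f, (φ f).gaussNorm ρ ≤ f.gaussNorm ρ) : Continuous φ := by
  refine continuous_of_continuousAt_zero φ ?_
  rw [ContinuousAt, map_zero, tendsto_zero_iff]
  exact fun ρ hρ => squeeze_zero (fun f => gaussNorm_nonneg _ hρ) (h ρ hρ)
    (tendsto_gaussNorm_nhds_zero hρ)

/-- The additive map `f ↦ f.coeff n`. -/
def coeffHom (n : ℤ) : AnalyticFunction k I →+ k where
  toFun f := f.coeff n
  map_zero' := rfl
  map_add' _ _ := rfl

theorem continuous_coeffHom (n : ℤ) :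
    Continuous (coeffHom n : AnalyticFunction k I →+ k) := by
  obtain ⟨ρ, hρ⟩ := I.exists_mem
  refine continuous_of_norm_le_gaussNorm (coeffHom n) (C := (ρ ^ n)⁻¹) hρ fun f => ?_
  rw [inv_mul_eq_div, le_div_iff₀ (zpow_pos (I.pos ρ hρ) n)]
  exact f.norm_coeff_mul_zpow_le_gaussNorm hρ n

theorem gaussNorm_le_of_tendsto {ι : Type*} {l : Filter ι} [l.NeBot]
    {F : ι → AnalyticFunction k I} {f : AnalyticFunction k I} {ρ C : ℝ} (hρ : ρ ∈ I)
    (hF : Tendsto F l (𝓝 f)) (h : ∀ᶠ i in l, (F i).gaussNorm ρ ≤ C) : f.gaussNorm ρ ≤ C := by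
  refine gaussNorm_le fun n => ?_
  refine le_of_tendsto ((((continuous_coeffHom n).tendsto f).comp hF).norm.mul_const (ρ ^ n)) ?_
  filter_upwards [h] with i hi
  exact (norm_coeff_mul_zpow_le_gaussNorm _ hρ n).trans hi

theorem exists_norm_coeff_sub_mul_zpow_le_of_cauchy {l : Filter (AnalyticFunction k I)}
    (hl : Cauchy l) {a : ℤ → k} (ha : ∀ n, Tendsto (fun f => f.coeff n) l (𝓝 (a n))) {ρ ε : ℝ}
    (hρ : ρ ∈ I) (hε : 0 < ε) :
    ∀ᶠ f : AnalyticFunction k I in l, ∀ n, ‖f.coeff n - a n‖ * ρ ^ n ≤ ε := by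
  have := hl.1
  let B := (ringSubgroupsBasis_gaussBall (k := k) (I := I)).toRingFilterBasis.toAddGroupFilterBasis
  obtain ⟨M, M_mem, gaussNorm_sub_le⟩ := (B.cauchy_iff.1 hl).2 _
    ((ringSubgroupsBasis_gaussBall (k := k) (I := I)).mem_addGroupFilterBasis
      ({⟨ρ, hρ⟩}, ⟨ε, hε⟩))
  filter_upwards [M_mem] with f hf n
  refine le_of_tendsto (((ha n).const_sub (f.coeff n)).norm.mul_const (ρ ^ n)) ?_
  filter_upwards [M_mem] with g hg
  exact (norm_coeff_mul_zpow_le_gaussNorm (f - g) hρ n).trans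
    (gaussNorm_sub_le g hg f hf ⟨ρ, hρ⟩ (Finset.mem_singleton_self _))

instance : CompleteSpace (AnalyticFunction k I) := by
  refine ⟨fun {l} hl => ?_⟩
  have := hl.1
  have exists_lim : ∀ n, ∃ a, Tendsto (fun f : AnalyticFunction k I => f.coeff n) l (𝓝 a) :=
    fun n => CompleteSpace.complete
      (hl.map (uniformContinuous_addMonoidHom_of_continuous (continuous_coeffHom n)))
  choose a ha using exists_lim
  have a_mem : a ∈ convergentLaurent k I := mem_convergentLaurent_of_forall_exists
    fun ρ hρ ε hε => (exists_norm_coeff_sub_mul_zpow_le_of_cauchy hl ha hρ hε).exists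
  let f : AnalyticFunction k I := ⟨a, a_mem⟩
  refine ⟨f, tendsto_id'.1 (tendsto_iff.2 fun ρ hρ => Metric.tendsto_nhds.2 fun ε hε => ?_)⟩
  filter_upwards [exists_norm_coeff_sub_mul_zpow_le_of_cauchy hl ha hρ (half_pos hε)] with g hg
  rw [dist_zero_right, Real.norm_of_nonneg (gaussNorm_nonneg _ hρ)]
  exact (gaussNorm_le (f := g - f) hg).trans_lt (half_lt_self hε)

theorem summable_of_tendsto_gaussNorm {ι : Type*} {F : ι → AnalyticFunction k I}
    (h : ∀ ρ ∈ I, Tendsto (fun i => (F i).gaussNorm ρ) cofinite (𝓝 0)) : Summable F :=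
  NonarchimedeanAddGroup.summable_of_tendsto_cofinite_zero (tendsto_zero_iff.2 h)

theorem gaussNorm_le_of_hasSum {ι : Type*} {F : ι → AnalyticFunction k I}
    {f : AnalyticFunction k I} {ρ C : ℝ} (hρ : ρ ∈ I) (hC : 0 ≤ C) (hF : HasSum F f)
    (h : ∀ i, (F i).gaussNorm ρ ≤ C) : f.gaussNorm ρ ≤ C :=
  gaussNorm_le_of_tendsto hρ hF
    (Eventually.of_forall fun s => gaussNorm_sum_le s hρ hC fun i _ => h i)

theorem hasSum_monomial (f : AnalyticFunction k I) :
    HasSum (fun i => monomial i (f.coeff i)) f := by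
  have summable : Summable fun i => (monomial i (f.coeff i) : AnalyticFunction k I) :=
    summable_of_tendsto_gaussNorm fun ρ hρ => squeeze_zero (fun i => gaussNorm_nonneg _ hρ)
      (fun i => gaussNorm_monomial_le i _ hρ) (f.tendsto_coeff hρ)
  convert summable.hasSum
  ext n
  refine HasSum.unique ?_ (summable.hasSum.map (coeffHom n) (continuous_coeffHom n))
  convert hasSum_ite_eq n (f.coeff n) using 2 with i
  change (monomial i (f.coeff i) : AnalyticFunction k I).coeff n = _
  rw [coeff_monomial]
  grind

end Topology

section Small

variable {k : Type*} [NormedField k] {I : RadiusInterval} {f g : AnalyticFunction k I}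

/-- All Gauss norms of `f` are less than one. -/
def IsSmall (f : AnalyticFunction k I) : Prop := ∀ ρ ∈ I, f.gaussNorm ρ < 1

theorem isSmall_zero : IsSmall (0 : AnalyticFunction k I) := fun ρ _ => by simp

theorem IsSmall.of_gaussNorm_le (hg : IsSmall g) (h : ∀ ρ ∈ I, f.gaussNorm ρ ≤ g.gaussNorm ρ) :
    IsSmall f := fun ρ hρ => (h ρ hρ).trans_lt (hg ρ hρ)

theorem IsSmall.smul (hf : IsSmall f) {c : k} (hc : ‖c‖ ≤ 1) : IsSmall (c • f) :=
  hf.of_gaussNorm_le fun _ hρ => (gaussNorm_smul_le c f hρ).trans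
    (mul_le_of_le_one_left (gaussNorm_nonneg f hρ) hc)

theorem IsSmall.neg (hf : IsSmall f) : IsSmall (-f) :=
  hf.of_gaussNorm_le fun ρ _ => (gaussNorm_neg ρ f).le

theorem IsSmall.sub [IsUltrametricDist k] (hf : IsSmall f) (hg : IsSmall g) : IsSmall (f - g) :=
  fun ρ hρ => (gaussNorm_sub_le f g hρ).trans_lt (max_lt (hf ρ hρ) (hg ρ hρ))

end Small

variable {k : Type*} [NormedField k] {I : RadiusInterval} [IsUltrametricDist k] [CompleteSpace k]

theorem exists_add_eq_of_gaussNorm_sub_le {Ψ : AnalyticFunction k I → AnalyticFunction k I}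
    {g : AnalyticFunction k I} {K : ℝ → ℝ} (K_nonneg : ∀ ρ ∈ I, 0 ≤ K ρ)
    (K_lt : ∀ ρ ∈ I, K ρ < 1) (map_zero : Ψ 0 = 0)
    (hΨ : ∀ s s', (∀ ρ ∈ I, s.gaussNorm ρ ≤ g.gaussNorm ρ) →
      (∀ ρ ∈ I, s'.gaussNorm ρ ≤ g.gaussNorm ρ) →
      ∀ ρ ∈ I, (Ψ s - Ψ s').gaussNorm ρ ≤ K ρ * (s - s').gaussNorm ρ) :
    ∃ s, (∀ ρ ∈ I, s.gaussNorm ρ ≤ g.gaussNorm ρ) ∧ s + Ψ s = g := by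
  let u : ℕ → AnalyticFunction k I := fun n => (fun s => g - Ψ s)^[n] 0
  have u_succ (n : ℕ) : u (n + 1) = g - Ψ (u n) := Function.iterate_succ_apply' _ n 0
  have gaussNorm_u_le (n : ℕ) : ∀ ρ ∈ I, (u n).gaussNorm ρ ≤ g.gaussNorm ρ := by
    induction n with
    | zero => intro ρ hρ; simpa [u] using gaussNorm_nonneg g hρ
    | succ n ih =>
      intro ρ hρ
      rw [u_succ]
      refine (gaussNorm_sub_le _ _ hρ).trans (max_le le_rfl ?_)
      have gaussNorm_Ψ_le := hΨ _ 0 ih (fun ρ hρ => by simpa using gaussNorm_nonneg g hρ) ρ hρ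
      rw [map_zero, sub_zero, sub_zero] at gaussNorm_Ψ_le
      exact gaussNorm_Ψ_le.trans ((mul_le_of_le_one_left (gaussNorm_nonneg _ hρ)
        (K_lt ρ hρ).le).trans (ih ρ hρ))
  have gaussNorm_step_le {ρ : ℝ} (hρ : ρ ∈ I) (n : ℕ) :
      (u (n + 1) - u n).gaussNorm ρ ≤ K ρ ^ n * (u 1 - u 0).gaussNorm ρ := by
    induction n with
    | zero => simp
    | succ n ih =>
      rw [u_succ (n + 1), ← gaussNorm_neg, neg_sub, pow_succ', mul_assoc]
      nth_rewrite 1 [u_succ n]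
      rw [sub_sub_sub_cancel_left]
      exact (hΨ _ _ (gaussNorm_u_le _) (gaussNorm_u_le _) ρ hρ).trans
        (mul_le_mul_of_nonneg_left ih (K_nonneg ρ hρ))
  obtain ⟨s, tendsto_u⟩ : ∃ s, Tendsto u atTop (𝓝 s) := by
    refine cauchySeq_tendsto_of_complete <|
      NonarchimedeanAddGroup.cauchySeq_of_tendsto_sub_nhds_zero <|
        tendsto_zero_iff.2 fun ρ hρ => ?_
    refine squeeze_zero (fun n => gaussNorm_nonneg _ hρ) (gaussNorm_step_le hρ) ?_
    simpa using (tendsto_pow_atTop_nhds_zero_of_lt_one (K_nonneg ρ hρ) (K_lt ρ hρ)).mul_const _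
  have gaussNorm_s_le : ∀ ρ ∈ I, s.gaussNorm ρ ≤ g.gaussNorm ρ := fun ρ hρ =>
    gaussNorm_le_of_tendsto hρ tendsto_u (Eventually.of_forall fun n => gaussNorm_u_le n ρ hρ)
  have tendsto_Ψ : Tendsto (fun n => Ψ (u n)) atTop (𝓝 (Ψ s)) := tendsto_iff.2 fun ρ hρ =>
    squeeze_zero (fun n => gaussNorm_nonneg _ hρ)
      (fun n => hΨ _ _ (gaussNorm_u_le n) gaussNorm_s_le ρ hρ)
      (by simpa using (tendsto_iff.1 tendsto_u ρ hρ).const_mul (K ρ))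
  refine ⟨s, gaussNorm_s_le, eq_sub_iff_add_eq.1 (tendsto_nhds_unique
    ((tendsto_add_atTop_iff_nat 1).2 tendsto_u) ?_)⟩
  simpa only [u_succ] using tendsto_Ψ.const_sub g

section Euler

/-- The Euler derivation `T d/dT`, which multiplies the `n`-th coefficient by `n`. -/
def euler : Derivation k (AnalyticFunction k I) (AnalyticFunction k I) :=
  Derivation.mk'
    { toFun := fun f => T * derivative f
      map_add' := fun f g => by
        rw [← mul_add]
        exact congrArg _ (ext fun n => mul_add _ _ _)
      map_smul' := fun c f => by
        rw [RingHom.id_apply, ← mul_smul_comm]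
        exact congrArg _ (ext fun n => mul_left_comm _ _ _) }
    fun f g => by
      change T * derivative (f * g) = f * (T * derivative g) + g * (T * derivative f)
      rw [derivative_mul]
      ring

theorem euler_apply (f : AnalyticFunction k I) : euler f = T * derivative f := rfl

@[simp]
theorem coeff_euler (f : AnalyticFunction k I) (n : ℤ) : (euler f).coeff n = n * f.coeff n := by
  rw [euler_apply, T, coeff_monomial_mul, coeff_derivative]
  simp

theorem gaussNorm_euler_le (f : AnalyticFunction k I) {ρ : ℝ} (hρ : ρ ∈ I) :
    (euler f).gaussNorm ρ ≤ f.gaussNorm ρ := gaussNorm_le fun n => by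
  rw [coeff_euler, norm_mul, mul_assoc]
  exact (mul_le_of_le_one_left (f.norm_coeff_mul_zpow_nonneg hρ n)
    (IsUltrametricDist.norm_intCast_le_one k n)).trans (f.norm_coeff_mul_zpow_le_gaussNorm hρ n)

theorem continuous_euler : Continuous (euler : AnalyticFunction k I → AnalyticFunction k I) :=
  continuous_of_gaussNorm_le euler fun _ hρ f => gaussNorm_euler_le f hρ

theorem euler_monomial (n : ℤ) (c : k) :
    euler (monomial n c : AnalyticFunction k I) = (n : k) • monomial n c := by
  ext i
  rw [coeff_euler, coeff_smul, coeff_monomial]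
  split_ifs with h
  · rw [h]
  · simp

end Euler

theorem gaussNorm_pow_succ_sub_pow_succ_le (x y : AnalyticFunction k I) {ρ κ : ℝ} (hρ : ρ ∈ I)
    (hx : x.gaussNorm ρ ≤ κ) (hy : y.gaussNorm ρ ≤ κ) (n : ℕ) :
    (x ^ (n + 1) - y ^ (n + 1)).gaussNorm ρ ≤ κ ^ n * (x - y).gaussNorm ρ := by
  have κ_nonneg := (gaussNorm_nonneg x hρ).trans hx
  induction n with
  | zero => simp
  | succ n ih =>
    rw [show x ^ (n + 1 + 1) - y ^ (n + 1 + 1) =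
      x * (x ^ (n + 1) - y ^ (n + 1)) + y ^ (n + 1) * (x - y) by ring]
    refine (gaussNorm_add_le _ _ hρ).trans (max_le ?_ ?_)
    · rw [pow_succ' κ, mul_assoc]
      exact (gaussNorm_mul_le _ _ hρ).trans (mul_le_mul hx ih (gaussNorm_nonneg _ hρ) κ_nonneg)
    · exact (gaussNorm_mul_le _ _ hρ).trans (mul_le_mul_of_nonneg_right
        ((gaussNorm_pow_le y hρ _).trans (pow_le_pow_left₀ (gaussNorm_nonneg y hρ) hy _))
        (gaussNorm_nonneg _ hρ))

section Exp

/-- The exponential series, which converges on small functions in residue characteristic zero. -/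
def exp (s : AnalyticFunction k I) : AnalyticFunction k I :=
  ∑' n : ℕ, ((n.factorial : k)⁻¹) • s ^ n

@[simp]
theorem exp_zero : exp (0 : AnalyticFunction k I) = 1 := by
  rw [exp, tsum_eq_single 0 fun n hn => by simp [hn]]
  simp

variable [CharZero (IsLocalRing.ResidueField (NormedField.valuation (K := k)).valuationSubring)]
  {s x y : AnalyticFunction k I}

theorem gaussNorm_inv_factorial_smul_le (n : ℕ) (f : AnalyticFunction k I) {ρ : ℝ} (hρ : ρ ∈ I) :
    (((n.factorial : k)⁻¹) • f).gaussNorm ρ ≤ f.gaussNorm ρ := by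
  simpa [norm_natCast_eq_one_of_charZero_residueField n.factorial_ne_zero]
    using gaussNorm_smul_le (n.factorial : k)⁻¹ f hρ

theorem hasSum_exp (hs : IsSmall s) :
    HasSum (fun n : ℕ => ((n.factorial : k)⁻¹) • s ^ n) (exp s) := by
  refine (summable_of_tendsto_gaussNorm fun ρ hρ => ?_).hasSum
  rw [Nat.cofinite_eq_atTop]
  exact squeeze_zero (fun n => gaussNorm_nonneg _ hρ)
    (fun n => (gaussNorm_inv_factorial_smul_le n _ hρ).trans (gaussNorm_pow_le s hρ n))
    (tendsto_pow_atTop_nhds_zero_of_lt_one (gaussNorm_nonneg s hρ) (hs ρ hρ))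

theorem inv_factorial_smul_add_pow (x y : AnalyticFunction k I) (n : ℕ) :
    ((n.factorial : k)⁻¹) • (x + y) ^ n = ∑ p ∈ Finset.HasAntidiagonal.antidiagonal n,
      (((p.1.factorial : k)⁻¹) • x ^ p.1) * (((p.2.factorial : k)⁻¹) • y ^ p.2) := by
  have := charZero_of_charZero_residueField k
  rw [(Commute.all x y).add_pow', Finset.smul_sum]
  refine Finset.sum_congr rfl fun p hp => ?_
  obtain rfl := Finset.HasAntidiagonal.mem_antidiagonal.1 hp
  have factorial_ne_zero (m : ℕ) : (m.factorial : k) ≠ 0 := Nat.cast_ne_zero.2 m.factorial_ne_zero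
  rw [smul_mul_smul_comm, ← Nat.cast_smul_eq_nsmul k, smul_smul, Nat.cast_add_choose]
  congr 1
  field_simp [factorial_ne_zero]

theorem exp_add (hx : IsSmall x) (hy : IsSmall y) : exp (x + y) = exp x * exp y := by
  have hasSum_x := hasSum_exp hx
  have hasSum_y := hasSum_exp hy
  have summable_mul := hasSum_x.summable.mul_of_nonarchimedean hasSum_y.summable
  have tsum_mul := hasSum_x.summable.tsum_mul_tsum_eq_tsum_sum_antidiagonal hasSum_y.summable
    summable_mul
  rw [hasSum_x.tsum_eq, hasSum_y.tsum_eq] at tsum_mul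
  rw [tsum_mul, exp]
  exact tsum_congr fun n => inv_factorial_smul_add_pow x y n

theorem gaussNorm_exp_sub_exp_sub_sub_le (hx : IsSmall x) (hy : IsSmall y) {ρ κ : ℝ} (hρ : ρ ∈ I)
    (hxκ : x.gaussNorm ρ ≤ κ) (hyκ : y.gaussNorm ρ ≤ κ) (hκ : κ ≤ 1) :
    (exp x - exp y - (x - y)).gaussNorm ρ ≤ κ * (x - y).gaussNorm ρ := by
  have κ_nonneg := (gaussNorm_nonneg x hρ).trans hxκ
  have gaussNorm_sub_nonneg := gaussNorm_nonneg (x - y) hρ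
  have bound_nonneg := mul_nonneg κ_nonneg gaussNorm_sub_nonneg
  have hasSum_tail := ((hasSum_exp hx).sub (hasSum_exp hy)).sub (hasSum_ite_eq 1 (x - y))
  refine gaussNorm_le_of_hasSum hρ bound_nonneg hasSum_tail fun n => ?_
  match n with
  | 0 => simpa using bound_nonneg
  | 1 => simpa using bound_nonneg
  | n + 2 =>
    rw [if_neg (by omega), sub_zero, ← smul_sub]
    refine (gaussNorm_inv_factorial_smul_le _ _ hρ).trans
      ((gaussNorm_pow_succ_sub_pow_succ_le x y hρ hxκ hyκ (n + 1)).trans ?_)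
    exact mul_le_mul_of_nonneg_right (pow_le_of_le_one κ_nonneg hκ (by omega)) gaussNorm_sub_nonneg

theorem isSmall_exp_sub_one (hs : IsSmall s) : IsSmall (exp s - 1) := by
  refine hs.of_gaussNorm_le fun ρ hρ => ?_
  have gaussNorm_sub_le : (exp s - 1 - s).gaussNorm ρ ≤ 1 * s.gaussNorm ρ := by
    simpa using gaussNorm_exp_sub_exp_sub_sub_le hs isSmall_zero hρ (hs ρ hρ).le (by simp) le_rfl
  rw [one_mul] at gaussNorm_sub_le
  rw [show exp s - 1 = exp s - 1 - s + s by ring]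
  exact (gaussNorm_add_le _ _ hρ).trans (max_le gaussNorm_sub_le le_rfl)

theorem euler_inv_factorial_succ_smul_pow_succ (s : AnalyticFunction k I) (n : ℕ) :
    euler ((((n + 1).factorial : k)⁻¹) • s ^ (n + 1)) =
      (((n.factorial : k)⁻¹) • s ^ n) * euler s := by
  have := charZero_of_charZero_residueField k
  rw [Derivation.map_smul, Derivation.leibniz_pow, ← Nat.cast_smul_eq_nsmul k, smul_smul,
    Nat.factorial_succ, Nat.add_sub_cancel, smul_mul_assoc, smul_eq_mul]
  congr 1
  have := Nat.cast_ne_zero (R := k).2 n.succ_ne_zero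
  push_cast at this ⊢
  field_simp

theorem euler_exp (hs : IsSmall s) : euler (exp s) = exp s * euler s := by
  have hasSum_euler := (hasSum_exp hs).map euler continuous_euler
  have hasSum_euler_succ := (hasSum_nat_add_iff' 1).2 hasSum_euler
  simp only [Finset.sum_range_one, Function.comp_apply, Nat.factorial_zero, Nat.cast_one, inv_one,
    pow_zero, one_smul, Derivation.map_one_eq_zero, sub_zero,
    euler_inv_factorial_succ_smul_pow_succ] at hasSum_euler_succ
  exact hasSum_euler_succ.unique ((hasSum_exp hs).mul_right (euler s))

/-- The exponential of a small function, as a unit. -/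
def expUnit (s : AnalyticFunction k I) (hs : IsSmall s) : (AnalyticFunction k I)ˣ where
  val := exp s
  inv := exp (-s)
  val_inv := by rw [← exp_add hs hs.neg, add_neg_cancel, exp_zero]
  inv_val := by rw [← exp_add hs.neg hs, neg_add_cancel, exp_zero]

@[simp]
theorem val_expUnit (hs : IsSmall s) : (expUnit s hs : AnalyticFunction k I) = exp s := rfl

theorem val_expUnit_zpow (hs : IsSmall s) (n : ℤ) :
    ((expUnit s hs ^ n : (AnalyticFunction k I)ˣ) : AnalyticFunction k I) = exp ((n : k) • s) := by
  have isSmall_smul (n : ℤ) : IsSmall ((n : k) • s) :=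
    hs.smul (IsUltrametricDist.norm_intCast_le_one k n)
  induction n using Int.induction_on with
  | zero => simp
  | succ n ih =>
    rw [zpow_add_one, Units.val_mul, ih, Int.cast_add, Int.cast_one, add_smul, one_smul,
      exp_add (isSmall_smul _) hs, val_expUnit]
  | pred n ih =>
    rw [zpow_sub_one, Units.val_mul, ih, Int.cast_sub, Int.cast_one, sub_smul, one_smul,
      sub_eq_add_neg, exp_add (isSmall_smul _) hs.neg]
    rfl

theorem exp_pow (hs : IsSmall s) (n : ℕ) : exp s ^ n = exp ((n : k) • s) := by
  simpa using val_expUnit_zpow hs n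

theorem exists_exp_add_mul_eq {a G : AnalyticFunction k I} (ha : IsSmall a)
    (hG : IsSmall (G - 1)) : ∃ s, IsSmall s ∧ exp s + a * s = G := by
  have contraction (s s' : AnalyticFunction k I)
      (hs : ∀ ρ ∈ I, s.gaussNorm ρ ≤ (G - 1).gaussNorm ρ)
      (hs' : ∀ ρ ∈ I, s'.gaussNorm ρ ≤ (G - 1).gaussNorm ρ) (ρ : ℝ) (hρ : ρ ∈ I) :
      (a * s + (exp s - 1 - s) - (a * s' + (exp s' - 1 - s'))).gaussNorm ρ ≤
        max (a.gaussNorm ρ) ((G - 1).gaussNorm ρ) * (s - s').gaussNorm ρ := by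
    have gaussNorm_sub_nonneg := gaussNorm_nonneg (s - s') hρ
    rw [show a * s + (exp s - 1 - s) - (a * s' + (exp s' - 1 - s')) =
      a * (s - s') + (exp s - exp s' - (s - s')) by ring]
    refine (gaussNorm_add_le _ _ hρ).trans (max_le ?_ ?_)
    · exact (gaussNorm_mul_le _ _ hρ).trans
        (mul_le_mul_of_nonneg_right (le_max_left _ _) gaussNorm_sub_nonneg)
    · exact (gaussNorm_exp_sub_exp_sub_sub_le (hG.of_gaussNorm_le hs) (hG.of_gaussNorm_le hs') hρ
        (hs ρ hρ) (hs' ρ hρ) (hG ρ hρ).le).trans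
          (mul_le_mul_of_nonneg_right (le_max_right _ _) gaussNorm_sub_nonneg)
  obtain ⟨s, gaussNorm_s_le, s_add⟩ := exists_add_eq_of_gaussNorm_sub_le
    (fun ρ hρ => le_max_of_le_left (gaussNorm_nonneg a hρ)) (fun ρ hρ => max_lt (ha ρ hρ) (hG ρ hρ))
    (by simp) contraction
  exact ⟨s, hG.of_gaussNorm_le gaussNorm_s_le, by linear_combination s_add⟩

theorem exists_pow_eq_of_isSmall_sub_one {G : AnalyticFunction k I} (hG : IsSmall (G - 1)) {n : ℕ}
    (hn : n ≠ 0) : ∃ v, IsSmall (v - 1) ∧ v ^ n = G := by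
  obtain ⟨s, hs, exp_s⟩ := exists_exp_add_mul_eq isSmall_zero hG
  have norm_n : ‖(n : k)‖ = 1 := norm_natCast_eq_one_of_charZero_residueField hn
  have isSmall_div : IsSmall ((n : k)⁻¹ • s) := hs.smul (by simp [norm_n])
  refine ⟨exp ((n : k)⁻¹ • s), isSmall_exp_sub_one isSmall_div, ?_⟩
  rw [exp_pow isSmall_div, smul_inv_smul₀ (norm_ne_zero_iff.1 (norm_n ▸ one_ne_zero)), ← exp_s,
    zero_mul, add_zero]

end Exp

section Evaluation

variable {B : Type*} [CommRing B] [Algebra k B] [UniformSpace B]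
  [NonarchimedeanRing B] [T2Space B] (τ : Bˣ)
  (hτ : ∀ f : AnalyticFunction k I,
    Summable fun i : ℤ => algebraMap k B (f.coeff i) * ((τ ^ i : Bˣ) : B))

/-- The evaluation `∑ aᵢ Tⁱ ↦ ∑ aᵢ τⁱ` at a unit `τ` of a topological `k`-algebra. -/
def evalLinearMap : AnalyticFunction k I →ₗ[k] B where
  toFun f := ∑' i : ℤ, algebraMap k B (f.coeff i) * ((τ ^ i : Bˣ) : B)
  map_add' f g := by
    rw [← (hτ f).tsum_add (hτ g)]
    simp only [coeff_add, map_add, add_mul]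
  map_smul' c f := by
    rw [RingHom.id_apply, Algebra.smul_def (A := B), ← (hτ f).tsum_mul_left]
    simp only [coeff_smul, map_mul, mul_assoc]

theorem hasSum_evalLinearMap (f : AnalyticFunction k I) :
    HasSum (fun i : ℤ => algebraMap k B (f.coeff i) * ((τ ^ i : Bˣ) : B)) (evalLinearMap τ hτ f) :=
  (hτ f).hasSum

theorem evalLinearMap_monomial (n : ℤ) (c : k) :
    evalLinearMap τ hτ (monomial n c) = algebraMap k B c * ((τ ^ n : Bˣ) : B) := by
  refine (tsum_eq_single n fun i hi => ?_).trans ?_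
  · simp [coeff_monomial, hi]
  · simp [coeff_monomial]

/-- A continuous evaluation, as a homomorphism of algebras. -/
def evalAlgHom [IsUniformAddGroup B] (hc : Continuous (evalLinearMap τ hτ)) :
    AnalyticFunction k I →ₐ[k] B :=
  AlgHom.ofLinearMap (evalLinearMap τ hτ) (by rw [one_def, evalLinearMap_monomial]; simp)
    fun f g => by
      have hasSum_mul := ((hasSum_monomial f).mul_of_nonarchimedean (hasSum_monomial g)).map
        (evalLinearMap τ hτ) hc
      refine hasSum_mul.unique ?_
      convert ((hasSum_monomial f).map (evalLinearMap τ hτ) hc).mul_of_nonarchimedean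
        ((hasSum_monomial g).map (evalLinearMap τ hτ) hc) using 1
      funext p
      simp only [Function.comp_apply, monomial_mul_monomial, evalLinearMap_monomial, map_mul,
        zpow_add, Units.val_mul]
      ring

end Evaluation

section Points

instance : NonarchimedeanRing k where
  is_nonarchimedean := NonarchimedeanAddGroup.is_nonarchimedean

variable (x : kˣ) (hx : ‖(x : k)‖ ∈ I) (f : AnalyticFunction k I)

include hx in
theorem summable_coeff_mul_zpow :
    Summable fun i : ℤ => algebraMap k k (f.coeff i) * ((x ^ i : kˣ) : k) := by
  refine NonarchimedeanAddGroup.summable_of_tendsto_cofinite_zero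
    (tendsto_zero_iff_norm_tendsto_zero.2 ((f.tendsto_coeff hx).congr fun i => ?_))
  rw [norm_mul, Units.val_zpow_eq_zpow_val, norm_zpow, Algebra.algebraMap_self_apply]

theorem norm_evalLinearMap_le :
    ‖evalLinearMap x (fun f => summable_coeff_mul_zpow x hx f) f‖ ≤ f.gaussNorm ‖(x : k)‖ := by
  refine norm_tsum_le_of_forall_le (gaussNorm_nonneg f hx) fun i => ?_
  rw [norm_mul, Units.val_zpow_eq_zpow_val, norm_zpow]
  exact f.norm_coeff_mul_zpow_le_gaussNorm hx i

/-- The evaluation of analytic functions at a `k`-rational point `x` of the annulus. -/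
def evalAt : AnalyticFunction k I →ₐ[k] k :=
  evalAlgHom x (fun f => summable_coeff_mul_zpow x hx f)
    (continuous_of_norm_le_gaussNorm _ (C := 1) hx fun f => by
      simpa using norm_evalLinearMap_le x hx f)

theorem evalAt_apply :
    evalAt x hx f = evalLinearMap x (fun f => summable_coeff_mul_zpow x hx f) f := rfl

theorem hasSum_evalAt : HasSum (fun i : ℤ => f.coeff i * (x : k) ^ i) (evalAt x hx f) := by
  rw [evalAt_apply]
  simpa using hasSum_evalLinearMap x (fun f => summable_coeff_mul_zpow x hx f) f

/-- The `k`-rational point `x` as a point `f ↦ ‖f(x)‖` of the Berkovich annulus. -/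
def rationalPoint : BerkovichAnnulus k I where
  toFun f := ‖evalAt x hx f‖
  map_zero' := by simp
  add_le' f g := by rw [map_add]; exact norm_add_le _ _
  neg' f := by rw [map_neg, norm_neg]
  map_one' := by simp
  map_mul' f g := by rw [map_mul, norm_mul]
  bounded := ⟨_, hx, _, hx, le_rfl, fun f =>
    (norm_evalLinearMap_le x hx f).trans_eq (max_self _).symm⟩

theorem absAt_rationalPoint : absAt (rationalPoint x hx) f = ‖evalAt x hx f‖ := rfl

end Points

end AnalyticFunction

section Points

variable {k : Type*} [NormedField k] {I : RadiusInterval} [IsUltrametricDist k] [CompleteSpace k]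

open AnalyticFunction

theorem absAt_one (x : BerkovichAnnulus k I) : absAt x 1 = 1 := map_one x.toMulRingSeminorm

theorem absAt_mul (x : BerkovichAnnulus k I) (f g : AnalyticFunction k I) :
    absAt x (f * g) = absAt x f * absAt x g := map_mul x.toMulRingSeminorm f g

theorem absAt_nonneg (x : BerkovichAnnulus k I) (f : AnalyticFunction k I) : 0 ≤ absAt x f :=
  apply_nonneg x.toMulRingSeminorm f

theorem absAt_le_of_forall_gaussNorm_le (x : BerkovichAnnulus k I) {f : AnalyticFunction k I}
    {C : ℝ} (h : ∀ ρ ∈ I, f.gaussNorm ρ ≤ C) : absAt x f ≤ C := by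
  obtain ⟨r, hr, R, hR, _, absAt_le⟩ := x.bounded
  exact (absAt_le f).trans (max_le (h r hr) (h R hR))

theorem absAt_lt_of_forall_gaussNorm_lt (x : BerkovichAnnulus k I) {f : AnalyticFunction k I}
    {C : ℝ} (h : ∀ ρ ∈ I, f.gaussNorm ρ < C) : absAt x f < C := by
  obtain ⟨r, hr, R, hR, _, absAt_le⟩ := x.bounded
  exact (absAt_le f).trans_lt (max_lt (h r hr) (h R hR))

/-- The image of a point under the map of annuli dual to an isometric homomorphism. -/
def comapPoint (φ : AnalyticFunction k I →ₐ[k] AnalyticFunction k I)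
    (hφ : ∀ ρ ∈ I, ∀ f, (φ f).gaussNorm ρ = f.gaussNorm ρ) (x : BerkovichAnnulus k I) :
    BerkovichAnnulus k I where
  toFun f := absAt x (φ f)
  map_zero' := by rw [map_zero]; exact map_zero x.toMulRingSeminorm
  add_le' f g := by rw [map_add]; exact map_add_le_add x.toMulRingSeminorm _ _
  neg' f := by rw [map_neg]; exact map_neg_eq_map x.toMulRingSeminorm _
  map_one' := by rw [map_one]; exact map_one x.toMulRingSeminorm
  map_mul' f g := by rw [map_mul]; exact map_mul x.toMulRingSeminorm _ _
  bounded := by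
    obtain ⟨r, hr, R, hR, hrR, absAt_le⟩ := x.bounded
    exact ⟨r, hr, R, hR, hrR, fun f => by rw [← hφ r hr f, ← hφ R hR f]; exact absAt_le (φ f)⟩

theorem isCoordinate_apply_T (φ : AnalyticFunction k I ≃ₐ[k] AnalyticFunction k I)
    (hφ : ∀ ρ ∈ I, ∀ f, (φ f).gaussNorm ρ = f.gaussNorm ρ) : IsCoordinate (φ T) := by
  refine ⟨I, φ, rfl, fun x => ⟨comapPoint φ.toAlgHom hφ x, fun f => rfl⟩, fun y => ?_⟩
  have hφ_symm (ρ : ℝ) (hρ : ρ ∈ I) (f : AnalyticFunction k I) :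
      (φ.symm f).gaussNorm ρ = f.gaussNorm ρ := by
    simpa using (hφ ρ hρ (φ.symm f)).symm
  refine ⟨comapPoint φ.symm.toAlgHom hφ_symm y, fun f => ?_⟩
  change absAt y f = absAt y (φ.symm (φ f))
  rw [AlgEquiv.symm_apply_apply]

end Points

namespace AnalyticFunction

variable {k : Type*} [NormedField k] {I : RadiusInterval} [IsUltrametricDist k]

theorem gaussNorm_eq_of_gaussNorm_sub_le {f g : AnalyticFunction k I} {ρ κ : ℝ} (hρ : ρ ∈ I)
    (hκ : κ < 1) (h : (g - f).gaussNorm ρ ≤ κ * f.gaussNorm ρ) :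
    g.gaussNorm ρ = f.gaussNorm ρ := by
  have gaussNorm_f_nonneg := gaussNorm_nonneg f hρ
  have gaussNorm_f_le := gaussNorm_sub_le g (g - f) hρ
  rw [sub_sub_cancel] at gaussNorm_f_le
  refine le_antisymm ?_ ?_
  · rw [← sub_add_cancel g f]
    exact (gaussNorm_add_le _ _ hρ).trans
      (max_le (h.trans (mul_le_of_le_one_left gaussNorm_f_nonneg hκ.le)) le_rfl)
  · by_contra! gaussNorm_g_lt
    have gaussNorm_f_pos := (gaussNorm_nonneg g hρ).trans_lt gaussNorm_g_lt
    exact gaussNorm_f_le.not_gt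
      (max_lt gaussNorm_g_lt (h.trans_lt (mul_lt_of_lt_one_left gaussNorm_f_pos hκ)))

variable [CompleteSpace k]

theorem bijective_of_gaussNorm_sub_le {F : Type*}
    [FunLike F (AnalyticFunction k I) (AnalyticFunction k I)]
    [AddMonoidHomClass F (AnalyticFunction k I) (AnalyticFunction k I)] (φ : F) {K : ℝ → ℝ}
    (K_nonneg : ∀ ρ ∈ I, 0 ≤ K ρ) (K_lt : ∀ ρ ∈ I, K ρ < 1)
    (hφ : ∀ ρ ∈ I, ∀ f, (φ f - f).gaussNorm ρ ≤ K ρ * f.gaussNorm ρ) :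
    Function.Bijective φ := by
  refine ⟨(injective_iff_map_eq_zero φ).2 fun f hf => ?_, fun g => ?_⟩
  · by_contra hf_ne
    obtain ⟨ρ, hρ⟩ := I.exists_mem
    have gaussNorm_eq := gaussNorm_eq_of_gaussNorm_sub_le hρ (K_lt ρ hρ) (hφ ρ hρ f)
    rw [hf, gaussNorm_zero] at gaussNorm_eq
    exact (gaussNorm_pos hf_ne hρ).ne gaussNorm_eq
  · obtain ⟨f, -, hf⟩ := exists_add_eq_of_gaussNorm_sub_le (Ψ := fun f => φ f - f) (g := g)
      K_nonneg K_lt (by simp) fun f f' _ _ ρ hρ => by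
        rw [sub_sub_sub_comm, ← map_sub]
        exact hφ ρ hρ (f - f')
    exact ⟨f, by rwa [add_sub_cancel] at hf⟩

section PrincipalUnit

theorem gaussNorm_le_one_of_isSmall_sub_one {f : AnalyticFunction k I} (hf : IsSmall (f - 1))
    {ρ : ℝ} (hρ : ρ ∈ I) : f.gaussNorm ρ ≤ 1 := by
  rw [← sub_add_cancel f 1]
  exact (gaussNorm_add_le _ _ hρ).trans (max_le (hf ρ hρ).le (gaussNorm_one_le hρ))

theorem gaussNorm_pow_sub_one_le {f : AnalyticFunction k I} (hf : IsSmall (f - 1)) (n : ℕ) {ρ : ℝ}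
    (hρ : ρ ∈ I) : (f ^ n - 1).gaussNorm ρ ≤ (f - 1).gaussNorm ρ := by
  cases n with
  | zero => simpa using gaussNorm_nonneg _ hρ
  | succ n =>
    simpa using gaussNorm_pow_succ_sub_pow_succ_le f 1 hρ
      (gaussNorm_le_one_of_isSmall_sub_one hf hρ) (gaussNorm_one_le hρ) n

variable {w : (AnalyticFunction k I)ˣ} (hw : IsSmall (w.val - 1))

include hw

theorem gaussNorm_val_inv_le_one {ρ : ℝ} (hρ : ρ ∈ I) :
    w⁻¹.val.gaussNorm ρ ≤ 1 := by
  have val_inv_eq : w⁻¹.val = 1 - w⁻¹.val * (w.val - 1) := by simp [mul_sub]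
  have gaussNorm_mul_le := gaussNorm_mul_le w⁻¹.val (w.val - 1) hρ
  by_contra! one_lt
  refine lt_irrefl (w⁻¹.val.gaussNorm ρ) ?_
  nth_rewrite 1 [val_inv_eq]
  refine (gaussNorm_sub_le _ _ hρ).trans_lt (max_lt ((gaussNorm_one_le hρ).trans_lt one_lt) ?_)
  exact gaussNorm_mul_le.trans_lt (mul_lt_of_lt_one_right (one_pos.trans one_lt) (hw ρ hρ))

theorem gaussNorm_val_inv_sub_one_le {ρ : ℝ} (hρ : ρ ∈ I) :
    (w⁻¹.val - 1).gaussNorm ρ ≤ (w.val - 1).gaussNorm ρ := by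
  rw [show (w⁻¹.val - 1) = -(w⁻¹.val * (w.val - 1)) by simp [mul_sub], gaussNorm_neg]
  exact (gaussNorm_mul_le _ _ hρ).trans
    (mul_le_of_le_one_left (gaussNorm_nonneg _ hρ) (gaussNorm_val_inv_le_one hw hρ))

theorem gaussNorm_val_zpow_sub_one_le (n : ℤ) {ρ : ℝ} (hρ : ρ ∈ I) :
    ((w ^ n).val - 1).gaussNorm ρ ≤ (w.val - 1).gaussNorm ρ := by
  obtain ⟨m, rfl | rfl⟩ := n.eq_nat_or_neg
  · simpa using gaussNorm_pow_sub_one_le hw m hρ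
  · have isSmall_pow : IsSmall ((w ^ m).val - 1) :=
      hw.of_gaussNorm_le fun ρ hρ => by simpa using gaussNorm_pow_sub_one_le hw m hρ
    rw [zpow_neg, zpow_natCast]
    exact (gaussNorm_val_inv_sub_one_le isSmall_pow hρ).trans
      (by simpa using gaussNorm_pow_sub_one_le hw m hρ)

theorem absAt_val_eq_one (x : BerkovichAnnulus k I) : absAt x w.val = 1 := by
  have absAt_val_le := absAt_le_of_forall_gaussNorm_le x fun ρ hρ =>
    gaussNorm_le_one_of_isSmall_sub_one hw hρ
  have absAt_inv_le := absAt_le_of_forall_gaussNorm_le x fun ρ hρ =>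
    gaussNorm_val_inv_le_one hw hρ
  refine absAt_val_le.antisymm ?_
  rw [← absAt_one x, ← w.mul_inv, absAt_mul]
  exact mul_le_of_le_one_right (absAt_nonneg x _) absAt_inv_le

theorem gaussNorm_algebraMap_mul_zpow_sub_monomial_le (n : ℤ) (c : k) {ρ : ℝ} (hρ : ρ ∈ I) :
    (algebraMap k (AnalyticFunction k I) c * ((unitT * w) ^ n).val - monomial n c).gaussNorm ρ ≤
      (w.val - 1).gaussNorm ρ * (‖c‖ * ρ ^ n) := by
  have sub_monomial_eq : algebraMap k (AnalyticFunction k I) c * ((unitT * w) ^ n).val -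
      monomial n c = ((w ^ n).val - 1) * monomial n c := by
    rw [mul_zpow, Units.val_mul, val_unitT_zpow, algebraMap_eq_monomial, ← mul_assoc,
      monomial_mul_monomial, zero_add, mul_one]
    ring
  rw [sub_monomial_eq]
  exact (gaussNorm_mul_le _ _ hρ).trans (mul_le_mul (gaussNorm_val_zpow_sub_one_le hw n hρ)
    (gaussNorm_monomial_le n c hρ) (gaussNorm_nonneg _ hρ) (gaussNorm_nonneg _ hρ))

theorem summable_coeff_mul_unitT_mul_zpow (f : AnalyticFunction k I) : Summable fun i : ℤ =>
    algebraMap k (AnalyticFunction k I) (f.coeff i) * ((unitT * w) ^ i).val := by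
  have summable_sub : Summable fun i : ℤ =>
      algebraMap k (AnalyticFunction k I) (f.coeff i) * ((unitT * w) ^ i).val -
        monomial i (f.coeff i) :=
    summable_of_tendsto_gaussNorm fun ρ hρ => squeeze_zero (fun i => gaussNorm_nonneg _ hρ)
      (fun i => gaussNorm_algebraMap_mul_zpow_sub_monomial_le hw i _ hρ)
      (by simpa using (f.tendsto_coeff hρ).const_mul _)
  simpa using summable_sub.add (hasSum_monomial f).summable

theorem gaussNorm_evalLinearMap_sub_le (f : AnalyticFunction k I) {ρ : ℝ} (hρ : ρ ∈ I) :
    (evalLinearMap (unitT * w) (summable_coeff_mul_unitT_mul_zpow hw) f - f).gaussNorm ρ ≤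
      (w.val - 1).gaussNorm ρ * f.gaussNorm ρ := by
  have gaussNorm_sub_one_nonneg := gaussNorm_nonneg (w.val - 1) hρ
  have hasSum_eval :=
    hasSum_evalLinearMap (unitT * w) (summable_coeff_mul_unitT_mul_zpow hw) f
  refine gaussNorm_le_of_hasSum hρ (mul_nonneg gaussNorm_sub_one_nonneg (gaussNorm_nonneg f hρ))
    (hasSum_eval.sub (hasSum_monomial f)) fun i => ?_
  exact (gaussNorm_algebraMap_mul_zpow_sub_monomial_le hw i _ hρ).trans
    (mul_le_mul_of_nonneg_left (f.norm_coeff_mul_zpow_le_gaussNorm hρ i) gaussNorm_sub_one_nonneg)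

theorem isCoordinate_unitT_mul : IsCoordinate (unitT * w).val := by
  have gaussNorm_eq (ρ : ℝ) (hρ : ρ ∈ I) (f : AnalyticFunction k I) :
      (evalLinearMap (unitT * w) (summable_coeff_mul_unitT_mul_zpow hw) f).gaussNorm ρ =
        f.gaussNorm ρ :=
    gaussNorm_eq_of_gaussNorm_sub_le hρ (hw ρ hρ) (gaussNorm_evalLinearMap_sub_le hw f hρ)
  let φ : AnalyticFunction k I →ₐ[k] AnalyticFunction k I :=
    evalAlgHom (unitT * w) (summable_coeff_mul_unitT_mul_zpow hw)
      (continuous_of_gaussNorm_le _ fun ρ hρ f => (gaussNorm_eq ρ hρ f).le)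
  have bijective_φ : Function.Bijective φ := bijective_of_gaussNorm_sub_le φ
    (fun ρ hρ => gaussNorm_nonneg _ hρ) hw fun ρ hρ f => gaussNorm_evalLinearMap_sub_le hw f hρ
  have φ_T : φ T = (unitT * w).val := by
    refine (evalLinearMap_monomial _ (summable_coeff_mul_unitT_mul_zpow hw) 1 1).trans ?_
    rw [map_one, one_mul, zpow_one]
  rw [← φ_T]
  exact isCoordinate_apply_T (AlgEquiv.ofBijective φ bijective_φ) gaussNorm_eq

end PrincipalUnit

end AnalyticFunction

theorem zpow_le_max_zpow {a b σ : ℝ} (ha : 0 < a) (hσ : σ ∈ Set.Icc a b) (i : ℤ) :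
    σ ^ i ≤ max (a ^ i) (b ^ i) := by
  have σ_pos : 0 < σ := ha.trans_le hσ.1
  rcases le_total 0 i with hi | hi
  · exact le_max_of_le_right (zpow_le_zpow_left₀ hi σ_pos.le hσ.2)
  · refine le_max_of_le_left ?_
    simpa only [zpow_neg, inv_inv] using
      inv_anti₀ (zpow_pos ha (-i)) (zpow_le_zpow_left₀ (neg_nonneg.2 hi) ha.le hσ.1)

namespace AnalyticFunction

/-- The index `m` is dominant for `f` at radius `ρ` when `aₘ Tᵐ` is the only term of maximal
absolute value at `ρ`; its coefficient is then nonzero. A zero-free `f` has the same dominant index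
at all radii. -/
def IsDominant {k : Type*} [NormedField k] {I : RadiusInterval} (f : AnalyticFunction k I) (ρ : ℝ)
    (m : ℤ) : Prop :=
  ∀ i ≠ m, ‖f.coeff i‖ * ρ ^ i < ‖f.coeff m‖ * ρ ^ m

section DominantIndex

variable {k : Type*} [NormedField k] {I : RadiusInterval} {f : AnalyticFunction k I} {ρ : ℝ}
  {m n : ℤ}

theorem IsDominant.eq (hm : IsDominant f ρ m) (hn : IsDominant f ρ n) : m = n := by
  by_contra hne
  exact lt_asymm (hm n (Ne.symm hne)) (hn m hne)

theorem IsDominant.norm_coeff_mul_zpow_pos (hm : IsDominant f ρ m) (hρ : ρ ∈ I) :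
    0 < ‖f.coeff m‖ * ρ ^ m :=
  (f.norm_coeff_mul_zpow_nonneg hρ (m + 1)).trans_lt (hm (m + 1) (by omega))

theorem IsDominant.coeff_ne_zero (hm : IsDominant f ρ m) (hρ : ρ ∈ I) : f.coeff m ≠ 0 :=
  norm_pos_iff.1 (pos_of_mul_pos_left (hm.norm_coeff_mul_zpow_pos hρ)
    (zpow_nonneg (I.pos ρ hρ).le m))

theorem eventually_cofinite_forall_norm_coeff_mul_zpow_lt (f : AnalyticFunction k I) {a b δ : ℝ}
    (ha : a ∈ I) (hb : b ∈ I) (hδ : 0 < δ) :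
    ∀ᶠ i in cofinite, ∀ σ ∈ Set.Icc a b, ‖f.coeff i‖ * σ ^ i < δ := by
  filter_upwards [(f.tendsto_coeff ha).eventually_lt_const hδ,
    (f.tendsto_coeff hb).eventually_lt_const hδ] with i lt_at_a lt_at_b σ hσ
  calc ‖f.coeff i‖ * σ ^ i ≤ ‖f.coeff i‖ * max (a ^ i) (b ^ i) :=
        mul_le_mul_of_nonneg_left (zpow_le_max_zpow (I.pos a ha) hσ i) (norm_nonneg _)
    _ = max (‖f.coeff i‖ * a ^ i) (‖f.coeff i‖ * b ^ i) := mul_max_of_nonneg _ _ (norm_nonneg _)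
    _ < δ := max_lt lt_at_a lt_at_b

theorem IsDominant.eventually_nhdsWithin_Icc (hm : IsDominant f ρ m) (hρ : ρ ∈ I) {a b : ℝ}
    (ha : a ∈ I) (hb : b ∈ I) : ∀ᶠ σ in 𝓝[Set.Icc a b] ρ, IsDominant f σ m := by
  have continuousAt_term (i : ℤ) : ContinuousAt (fun σ : ℝ => ‖f.coeff i‖ * σ ^ i) ρ :=
    continuousAt_const.mul (continuousAt_zpow₀ ρ i (Or.inl (I.pos ρ hρ).ne'))
  obtain ⟨δ, δ_pos, δ_lt⟩ := exists_between (hm.norm_coeff_mul_zpow_pos hρ)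
  have finite_large : {i | ¬ ∀ σ ∈ Set.Icc a b, ‖f.coeff i‖ * σ ^ i < δ}.Finite :=
    eventually_cofinite.1 (f.eventually_cofinite_forall_norm_coeff_mul_zpow_lt ha hb δ_pos)
  have dominates_large : ∀ᶠ σ in 𝓝 ρ, ∀ i ∈ finite_large.toFinset, i ≠ m →
      ‖f.coeff i‖ * σ ^ i < ‖f.coeff m‖ * σ ^ m := by
    refine (eventually_all_finset _).2 fun i _ => ?_
    by_cases him : i = m
    · exact Eventually.of_forall fun _ hne => absurd him hne
    · filter_upwards [(continuousAt_term i).eventually_lt (continuousAt_term m) (hm i him)]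
        with σ hσ _ using hσ
  filter_upwards [nhdsWithin_le_nhds ((continuousAt_term m).eventually_const_lt δ_lt),
    nhdsWithin_le_nhds dominates_large, self_mem_nhdsWithin] with σ δ_lt_term dominates hσ i him
  by_cases hi : ∀ σ ∈ Set.Icc a b, ‖f.coeff i‖ * σ ^ i < δ
  · exact (hi σ hσ).trans δ_lt_term
  · exact dominates i (finite_large.mem_toFinset.2 hi) him

theorem exists_forall_isDominant (h : ∀ ρ ∈ I, ∃ m, IsDominant f ρ m) :
    ∃ m, ∀ ρ ∈ I, IsDominant f ρ m := by
  choose! index index_dominant using h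
  have index_eq_of_le : ∀ a ∈ I, ∀ b ∈ I, a ≤ b → index a = index b := by
    intro a ha b hb hab
    have mem_of_mem_Icc : ∀ σ ∈ Set.Icc a b, σ ∈ I := fun σ hσ =>
      I.ordConnected_carrier.out ha hb hσ
    have index_continuousOn : ContinuousOn index (Set.Icc a b) := by
      intro ρ hρ
      rw [ContinuousWithinAt, nhds_discrete, tendsto_pure]
      have hρI := mem_of_mem_Icc ρ hρ
      filter_upwards [(index_dominant ρ hρI).eventually_nhdsWithin_Icc hρI ha hb,
        self_mem_nhdsWithin] with σ hdom hσ
      exact (index_dominant σ (mem_of_mem_Icc σ hσ)).eq hdom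
    exact isPreconnected_Icc.constant index_continuousOn (Set.left_mem_Icc.2 hab)
      (Set.right_mem_Icc.2 hab)
  obtain ⟨ρ₀, hρ₀⟩ := I.exists_mem
  refine ⟨index ρ₀, fun ρ hρ => ?_⟩
  have index_eq : index ρ₀ = index ρ :=
    (le_total ρ₀ ρ).elim (index_eq_of_le ρ₀ hρ₀ ρ hρ) fun h => (index_eq_of_le ρ hρ ρ₀ hρ₀ h).symm
  exact index_eq ▸ index_dominant ρ hρ

end DominantIndex

section ZeroFree

variable {k : Type*} [NormedField k] {I : RadiusInterval} [IsUltrametricDist k] [CompleteSpace k]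
  {f : AnalyticFunction k I}

theorem exists_eq_monomial_mul_of_forall_isDominant {m : ℤ} (hm : ∀ ρ ∈ I, IsDominant f ρ m) :
    ∃ w : AnalyticFunction k I, IsSmall (w - 1) ∧ f = monomial m (f.coeff m) * w := by
  obtain ⟨ρ₀, hρ₀⟩ := I.exists_mem
  have hc : f.coeff m ≠ 0 := (hm ρ₀ hρ₀).coeff_ne_zero hρ₀
  refine ⟨monomial (-m) (f.coeff m)⁻¹ * f, fun ρ hρ => gaussNorm_lt hρ fun i => ?_, ?_⟩
  · have ρ_pos := I.pos ρ hρ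
    rw [coeff_sub, coeff_monomial_mul, one_def, coeff_monomial, sub_neg_eq_add]
    split_ifs with hi
    · simp [hi, hc]
    · have term_lt := hm ρ hρ (i + m) (by omega)
      rw [zpow_add₀ ρ_pos.ne', ← mul_assoc] at term_lt
      rw [sub_zero, norm_mul, norm_inv, mul_assoc, inv_mul_lt_one₀ (norm_pos_iff.2 hc)]
      exact lt_of_mul_lt_mul_right term_lt (zpow_pos ρ_pos m).le
  · rw [← mul_assoc, monomial_mul_monomial, add_neg_cancel, mul_inv_cancel₀ hc, ← one_def, one_mul]

variable [IsAlgClosed k]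

theorem exists_absAt_eq_zero (hf : f ≠ 0) {ρ : ℝ} (hρ : ρ ∈ I) {i j : ℤ} (hij : i ≠ j)
    (hi : ‖f.coeff i‖ * ρ ^ i = f.gaussNorm ρ) (hj : ‖f.coeff j‖ * ρ ^ j = f.gaussNorm ρ) :
    ∃ x : BerkovichAnnulus k I, absAt x f = 0 := by
  have ρ_pos := I.pos ρ hρ
  have norm_pos := gaussNorm_pos hf hρ
  have coeff_ne_zero {n : ℤ} (hn : ‖f.coeff n‖ * ρ ^ n = f.gaussNorm ρ) : f.coeff n ≠ 0 := by
    intro h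
    rw [h, norm_zero, zero_mul] at hn
    exact norm_pos.ne hn
  have norm_quotient : ‖f.coeff i / f.coeff j‖ = ρ ^ (j - i) := by
    rw [norm_div, zpow_sub₀ ρ_pos.ne', div_eq_div_iff (norm_ne_zero_iff.2 (coeff_ne_zero hj))
      (zpow_pos ρ_pos i).ne', hi, mul_comm, hj]
  obtain ⟨α, hα⟩ := exists_norm_eq_of_norm_eq_zpow ρ_pos (sub_ne_zero.2 hij.symm) norm_quotient
  have α_ne_zero : α ≠ 0 := norm_ne_zero_iff.1 (hα ▸ ρ_pos.ne')
  let b (n : ℤ) : k := f.coeff n * α ^ n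
  have norm_b (n : ℤ) : ‖b n‖ = ‖f.coeff n‖ * ρ ^ n := by rw [norm_mul, norm_zpow, hα]
  have b_tendsto : Tendsto b cofinite (𝓝 0) :=
    tendsto_zero_iff_norm_tendsto_zero.2 ((f.tendsto_coeff hρ).congr fun n => (norm_b n).symm)
  obtain ⟨l, u, hlu, hext⟩ := exists_hasExtremes b_tendsto
    (mul_ne_zero (coeff_ne_zero hi) (zpow_ne_zero i α_ne_zero))
    (fun n => by rw [norm_b, norm_b, hi]; exact f.norm_coeff_mul_zpow_le_gaussNorm hρ n)
    hij (by rw [norm_b, norm_b, hi, hj])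
  obtain ⟨z, norm_z, hz⟩ := hext.exists_zero hlu b_tendsto
  have z_ne_zero : z ≠ 0 := norm_ne_zero_iff.1 (norm_z ▸ one_ne_zero)
  let x : kˣ := Units.mk0 (α * z) (mul_ne_zero α_ne_zero z_ne_zero)
  have hx : ‖(x : k)‖ ∈ I := by rwa [Units.val_mk0, norm_mul, hα, norm_z, mul_one]
  have hasSum_zero : HasSum (fun n => f.coeff n * (x : k) ^ n) 0 := by
    simpa only [b, x, Units.val_mk0, mul_zpow, mul_assoc] using hz
  refine ⟨rationalPoint x hx, ?_⟩
  rw [absAt_rationalPoint, (hasSum_evalAt x hx f).unique hasSum_zero, norm_zero]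

theorem exists_isDominant (hf : f ≠ 0) (h : ∀ x : BerkovichAnnulus k I, absAt x f ≠ 0) {ρ : ℝ}
    (hρ : ρ ∈ I) : ∃ m, IsDominant f ρ m := by
  obtain ⟨m, hm⟩ := f.exists_norm_coeff_mul_zpow_eq_gaussNorm hρ
  refine ⟨m, fun i hi => hm ▸ (f.norm_coeff_mul_zpow_le_gaussNorm hρ i).lt_of_ne fun heq => ?_⟩
  obtain ⟨x, hx⟩ := exists_absAt_eq_zero hf hρ hi heq hm
  exact h x hx

theorem exists_eq_monomial_mul (hf : f ≠ 0) (h : ∀ x : BerkovichAnnulus k I, absAt x f ≠ 0) :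
    ∃ (m : ℤ) (c : k) (w : AnalyticFunction k I), c ≠ 0 ∧ IsSmall (w - 1) ∧
      f = monomial m c * w := by
  obtain ⟨m, hm⟩ := exists_forall_isDominant fun ρ hρ => exists_isDominant hf h hρ
  obtain ⟨w, hw, hfw⟩ := exists_eq_monomial_mul_of_forall_isDominant hm
  refine ⟨m, f.coeff m, w, fun hc => hf ?_, hw, hfw⟩
  rw [hfw, hc]
  ext i
  simp [coeff_monomial_mul]

end ZeroFree

section DifferentialEquation

variable {k : Type*} [NormedField k] {I : RadiusInterval}

theorem exists_coeff_eq {f : AnalyticFunction k I} {b : ℤ → k} (hb : ∀ i, ‖b i‖ ≤ ‖f.coeff i‖) :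
    ∃ g : AnalyticFunction k I, ∀ i, g.coeff i = b i :=
  ⟨⟨b, fun ρ hρ => squeeze_zero
    (fun i => mul_nonneg (norm_nonneg _) (zpow_nonneg (I.pos ρ hρ).le i))
    (fun i => mul_le_mul_of_nonneg_right (hb i) (zpow_nonneg (I.pos ρ hρ).le i))
    (f.tendsto_coeff hρ)⟩, fun _ => rfl⟩

theorem IsSmall.monomial_coeff {f : AnalyticFunction k I} (hf : IsSmall f) (n : ℤ) :
    IsSmall (monomial n (f.coeff n) : AnalyticFunction k I) :=
  hf.of_gaussNorm_le fun _ hρ => (gaussNorm_monomial_le n _ hρ).trans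
    (f.norm_coeff_mul_zpow_le_gaussNorm hρ n)

variable [IsUltrametricDist k] [CompleteSpace k]

theorem exists_euler_add_smul_eq {e : k} {w : AnalyticFunction k I}
    (h : ∀ i, w.coeff i ≠ 0 → ‖(i : k) + e‖ = 1) :
    ∃ g, euler g + e • g = w ∧ ∀ ρ ∈ I, g.gaussNorm ρ ≤ w.gaussNorm ρ := by
  have norm_div_eq (i : ℤ) : ‖w.coeff i / (i + e)‖ = ‖w.coeff i‖ := by
    by_cases hi : w.coeff i = 0
    · simp [hi]
    · rw [norm_div, h i hi, div_one]
  obtain ⟨g, coeff_g⟩ := exists_coeff_eq fun i => (norm_div_eq i).le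
  refine ⟨g, ext fun i => ?_, fun ρ hρ => gaussNorm_le fun i => ?_⟩
  · rw [coeff_add, coeff_euler, coeff_smul, ← add_mul, coeff_g]
    by_cases hi : w.coeff i = 0
    · simp [hi]
    · exact mul_div_cancel₀ _ (norm_ne_zero_iff.1 (h i hi ▸ one_ne_zero))
  · rw [coeff_g, norm_div_eq]
    exact w.norm_coeff_mul_zpow_le_gaussNorm hρ i

theorem coeff_sub_one {i : ℤ} (hi : i ≠ 0) (v : AnalyticFunction k I) :
    (v - 1).coeff i = v.coeff i := by
  rw [coeff_sub, one_def, coeff_monomial, if_neg hi, sub_zero]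

theorem norm_coeff_zero_eq_one {v : AnalyticFunction k I} (hv : IsSmall (v - 1)) :
    ‖v.coeff 0‖ = 1 := by
  obtain ⟨ρ, hρ⟩ := I.exists_mem
  have norm_sub_one_lt : ‖v.coeff 0 - 1‖ < 1 := by
    simpa [one_def, coeff_monomial] using
      ((v - 1).norm_coeff_mul_zpow_le_gaussNorm hρ 0).trans_lt (hv ρ hρ)
  rw [← sub_sub_self 1 (v.coeff 0), norm_sub_eq_left_of_norm_lt, norm_one]
  rwa [norm_one, norm_sub_rev]

variable [CharZero (IsLocalRing.ResidueField (NormedField.valuation (K := k)).valuationSubring)]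
  {v : AnalyticFunction k I}

/- Let `L` be the left-hand side and `σ = e • s`. Then `d (T ^ e (exp σ + a σ))` equals
`e T ^ e (L - a) dT / T`, so the equation integrates to `exp σ + a σ = G` for a solution `G` of
`T dG / dT + e G = e (v - a)`. -/
theorem exists_exp_add_mul_one_add_euler_eq {e : k} (he : ‖e‖ = 1) {a : AnalyticFunction k I}
    (ha : IsSmall a) (euler_a : euler a = -(e • a)) (hv : IsSmall (v - 1))
    (h : ∀ i, (v - 1 - a).coeff i ≠ 0 → ‖(i : k) + e‖ = 1) :
    ∃ s, IsSmall s ∧ (exp (e • s) + a) * (1 + euler s) = v := by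
  have e_ne_zero : e ≠ 0 := norm_ne_zero_iff.1 (he ▸ one_ne_zero)
  have isSmall_rhs : IsSmall (e • (v - 1 - a)) := (hv.sub ha).smul he.le
  obtain ⟨g, euler_g, gaussNorm_g_le⟩ := exists_euler_add_smul_eq (w := e • (v - 1 - a))
    fun i hi => h i (right_ne_zero_of_mul hi)
  have isSmall_G : IsSmall (1 + g - 1) := by
    rw [add_sub_cancel_left]
    exact isSmall_rhs.of_gaussNorm_le gaussNorm_g_le
  obtain ⟨σ, hσ, exp_σ⟩ := exists_exp_add_mul_eq ha isSmall_G
  have euler_eq : exp σ * euler σ + (a * euler σ + σ * -(e • a)) = euler g := by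
    simpa [euler_exp hσ, euler_a] using congrArg euler exp_σ
  refine ⟨e⁻¹ • σ, hσ.smul (by simp [he]), smul_right_injective _ e_ne_zero ?_⟩
  change e • ((exp (e • e⁻¹ • σ) + a) * (1 + euler (e⁻¹ • σ))) = e • v
  calc e • ((exp (e • e⁻¹ • σ) + a) * (1 + euler (e⁻¹ • σ)))
      = (exp σ + a) * (e • (1 + e⁻¹ • euler σ)) := by
        rw [smul_inv_smul₀ e_ne_zero, euler.map_smul, mul_smul_comm]
    _ = (exp σ + a) * (e • 1 + euler σ) := by rw [smul_add, smul_inv_smul₀ e_ne_zero]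
    _ = e • v := by
        simp only [Algebra.smul_def] at euler_eq euler_g ⊢
        linear_combination euler_eq + euler_g + algebraMap k (AnalyticFunction k I) e * exp_σ

theorem exists_exp_intCast_smul_add_monomial_mul_one_add_euler_eq {d : ℤ} (hd : d ≠ 0)
    (hv : IsSmall (v - 1)) :
    ∃ s, IsSmall s ∧
      (exp ((d : k) • s) + monomial (-d) (v.coeff (-d))) * (1 + euler s) = v := by
  rw [← coeff_sub_one (neg_ne_zero.2 hd) v]
  refine exists_exp_add_mul_one_add_euler_eq (norm_intCast_eq_one_of_charZero_residueField hd)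
    (hv.monomial_coeff (-d)) (by simp [euler_monomial]) hv fun i hi => ?_
  have i_add_d_ne_zero : i + d ≠ 0 := by
    intro h
    simp [eq_neg_of_add_eq_zero_left h, coeff_monomial] at hi
  exact_mod_cast norm_intCast_eq_one_of_charZero_residueField (k := k) i_add_d_ne_zero

theorem exists_exp_smul_mul_one_add_euler_eq {q : ℕ} (hq : q ≠ 0) {m : ℤ} (hm : ¬ (q : ℤ) ∣ m)
    (hv : IsSmall (v - 1)) :
    ∃ s, IsSmall s ∧ exp (((m : k) / q) • s) * (1 + euler s) = v := by
  have norm_q : ‖(q : k)‖ = 1 := norm_natCast_eq_one_of_charZero_residueField hq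
  have norm_add (i : ℤ) : ‖(i : k) + m / q‖ = 1 := by
    have num_ne_zero : i * q + m ≠ 0 := fun h => hm ⟨-i, by linear_combination h⟩
    rw [add_div' _ _ _ (norm_ne_zero_iff.1 (norm_q ▸ one_ne_zero)), norm_div, norm_q, div_one]
    exact_mod_cast norm_intCast_eq_one_of_charZero_residueField (k := k) num_ne_zero
  simpa only [add_zero] using exists_exp_add_mul_one_add_euler_eq
    (by simpa using norm_add 0) isSmall_zero (by simp) hv fun i _ => norm_add i

theorem exists_coeff_zero_smul_one_add_euler_eq (hv : IsSmall (v - 1)) :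
    ∃ s, IsSmall s ∧ v.coeff 0 • (1 + euler s) = v := by
  have norm_coeff := norm_coeff_zero_eq_one hv
  have coeff_ne_zero : v.coeff 0 ≠ 0 := norm_ne_zero_iff.1 (norm_coeff ▸ one_ne_zero)
  obtain ⟨g, euler_g, gaussNorm_g_le⟩ := exists_euler_add_smul_eq (e := 0)
    (w := v - 1 - monomial 0 ((v - 1).coeff 0)) fun i hi => by
      rw [add_zero]
      refine norm_intCast_eq_one_of_charZero_residueField fun h => ?_
      simp [h, coeff_monomial] at hi
  have isSmall_g : IsSmall g := (hv.sub (hv.monomial_coeff 0)).of_gaussNorm_le gaussNorm_g_le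
  have euler_g_eq : euler g = v - v.coeff 0 • 1 := by
    rw [zero_smul, add_zero] at euler_g
    rw [euler_g, coeff_sub]
    ext i
    simp only [coeff_sub, coeff_smul, one_def, coeff_monomial, if_true]
    split_ifs <;> ring
  refine ⟨(v.coeff 0)⁻¹ • g, isSmall_g.smul (by simp [norm_coeff]), ?_⟩
  rw [euler.map_smul, smul_add, smul_inv_smul₀ coeff_ne_zero, euler_g_eq, add_sub_cancel]

end DifferentialEquation

section QDifferential

variable {k : Type*} [NormedField k] {I : RadiusInterval} [IsUltrametricDist k] [CompleteSpace k]
  {q : ℕ}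

theorem derivative_T : derivative (T : AnalyticFunction k I) = 1 := by
  ext n
  rw [coeff_derivative, T, one_def, coeff_monomial, coeff_monomial]
  by_cases hn : n = 0 <;> simp [hn]

theorem exteriorD_eq_derivative_smul (f : AnalyticFunction k I) :
    exteriorD k I f = derivative f • exteriorD k I T := by
  change derivative f = derivative f * derivative T
  rw [derivative_T, mul_one]

theorem exists_eq_smul_exteriorD_T (ω : DifferentialForm k I) :
    ∃ g : AnalyticFunction k I, ω = g • exteriorD k I T := by
  let g : AnalyticFunction k I := ω
  refine ⟨g, ?_⟩
  change g = g * derivative T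
  rw [derivative_T, mul_one]

theorem dlogPow_eq_smul_dlogPow_unitT (q : ℕ) (t : (AnalyticFunction k I)ˣ) :
    dlogPow q t = (t⁻¹.val * euler t.val) ^ q • dlogPow q unitT := by
  have dlog_eq : t⁻¹.val • exteriorD k I t.val = (t⁻¹.val * euler t.val) •
      ((unitT : (AnalyticFunction k I)ˣ)⁻¹.val • exteriorD k I unitT.val) := by
    have T_mul_inv : T * (unitT : (AnalyticFunction k I)ˣ)⁻¹.val = 1 := unitT.mul_inv
    rw [exteriorD_eq_derivative_smul t.val, smul_smul, smul_smul, euler_apply]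
    refine congrArg (· • exteriorD k I T) ?_
    linear_combination (-t⁻¹.val * derivative t.val) * T_mul_inv
  simp only [dlogPow, dlog_eq, MultilinearMap.map_smul_univ, Finset.prod_const, Finset.card_univ,
    Fintype.card_fin]

theorem exists_eq_smul_dlogPow_unitT (ξ : QDifferential k I q) :
    ∃ f : AnalyticFunction k I, ξ = f • dlogPow q unitT := by
  induction ξ using PiTensorProduct.induction_on with
  | smul_tprod r ω =>
    choose g hg using fun i => exists_eq_smul_exteriorD_T (ω i)
    let u : (AnalyticFunction k I)ˣ := unitT
    have ω_eq : ω = fun i => (g i * u.val) • (u⁻¹.val • exteriorD k I u.val) := by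
      funext i
      rw [smul_smul, mul_assoc, Units.mul_inv, mul_one]
      exact hg i
    exact ⟨r * ∏ i, g i * u.val, by rw [ω_eq, MultilinearMap.map_smul_univ, smul_smul, dlogPow]⟩
  | add ξ η hξ hη =>
    obtain ⟨f, rfl⟩ := hξ
    obtain ⟨g, rfl⟩ := hη
    exact ⟨f + g, (add_smul f g _).symm⟩

theorem hasZeroAt_smul {f : AnalyticFunction k I} {x : BerkovichAnnulus k I}
    (h : absAt x f = 0) (ξ : QDifferential k I q) : HasZeroAt (f • ξ) x :=
  Submodule.smul_mem_smul (I := vanishingIdeal x) h Submodule.mem_top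

theorem dlogPow_unitT_mul_expUnit
    [CharZero (IsLocalRing.ResidueField (NormedField.valuation (K := k)).valuationSubring)]
    {s : AnalyticFunction k I} (hs : IsSmall s) (q : ℕ) :
    dlogPow q (unitT * expUnit s hs) = (1 + euler s) ^ q • dlogPow q unitT := by
  have euler_eq : euler (unitT * expUnit s hs).val =
      (unitT * expUnit s hs).val * (1 + euler s) := by
    have euler_unitT : euler (unitT : (AnalyticFunction k I)ˣ).val = unitT.val := by
      rw [euler_apply]
      exact (congrArg _ derivative_T).trans (mul_one _)
    rw [Units.val_mul, Derivation.leibniz, val_expUnit, euler_exp hs, euler_unitT, smul_eq_mul,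
      smul_eq_mul]
    ring
  rw [dlogPow_eq_smul_dlogPow_unitT, euler_eq, Units.inv_mul_cancel_left]

end QDifferential

section NormalForm

variable {k : Type*} [NormedField k] {I : RadiusInterval} [IsUltrametricDist k] [CompleteSpace k]

theorem absAt_algebraMap_mul_coeff_lt {c : k} (hc : c ≠ 0) {v : AnalyticFunction k I}
    (hv : IsSmall (v - 1)) {d : ℤ} (hd : d ≠ 0) {w : (AnalyticFunction k I)ˣ}
    (hw : IsSmall (w.val - 1)) (x : BerkovichAnnulus k I) :
    absAt x (algebraMap k _ (c * v.coeff (-d))) <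
      absAt x (algebraMap k _ c * ((unitT * w) ^ d).val) := by
  let u : (AnalyticFunction k I)ˣ :=
    Units.map (algebraMap k (AnalyticFunction k I)) (Units.mk0 c hc) * unitT ^ d
  have val_u : u.val = algebraMap k _ c * (unitT ^ d).val := rfl
  have absAt_u_pos : 0 < absAt x u.val := by
    refine (absAt_nonneg x _).lt_of_ne' fun absAt_eq_zero => ?_
    have absAt_mul_inv := absAt_mul x u.val u⁻¹.val
    rw [u.mul_inv, absAt_one, absAt_eq_zero, zero_mul] at absAt_mul_inv
    exact one_ne_zero absAt_mul_inv
  have isSmall_monomial : IsSmall (monomial (-d) (v.coeff (-d)) : AnalyticFunction k I) := by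
    rw [← coeff_sub_one (neg_ne_zero.2 hd) v]
    exact hv.monomial_coeff (-d)
  have left_eq : algebraMap k (AnalyticFunction k I) (c * v.coeff (-d)) =
      u.val * monomial (-d) (v.coeff (-d)) := by
    rw [val_u, val_unitT_zpow, mul_assoc, monomial_mul_monomial, add_neg_cancel, one_mul,
      ← algebraMap_eq_monomial, map_mul]
  have absAt_zpow : absAt x (w ^ d).val = 1 :=
    absAt_val_eq_one (fun ρ hρ => (gaussNorm_val_zpow_sub_one_le hw d hρ).trans_lt (hw ρ hρ)) x
  have right_eq : algebraMap k (AnalyticFunction k I) c * ((unitT * w) ^ d).val =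
      u.val * (w ^ d).val := by
    rw [val_u, mul_zpow, Units.val_mul, mul_assoc]
  rw [left_eq, right_eq, absAt_mul, absAt_mul, absAt_zpow]
  exact mul_lt_mul_of_pos_left (absAt_lt_of_forall_gaussNorm_lt x isSmall_monomial) absAt_u_pos

variable [CharZero (IsLocalRing.ResidueField (NormedField.valuation (K := k)).valuationSubring)]

theorem exists_eq_smul_dlogPow_of_forall_not_hasZeroAt [IsAlgClosed k] {q : ℕ} (hq : q ≠ 0)
    {ξ : QDifferential k I q} (hξ : ∀ x, ¬ HasZeroAt ξ x) (hξ₀ : ξ ≠ 0) :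
    ∃ (m : ℤ) (c : k) (v : AnalyticFunction k I), c ≠ 0 ∧ IsSmall (v - 1) ∧
      ξ = (algebraMap k _ (c ^ q) * ((unitT ^ m).val * v ^ q)) • dlogPow q unitT := by
  obtain ⟨f, rfl⟩ := exists_eq_smul_dlogPow_unitT ξ
  have hf : f ≠ 0 := fun h => hξ₀ (by rw [h, zero_smul])
  obtain ⟨m, b, w, hb, hw, rfl⟩ :=
    exists_eq_monomial_mul hf fun x hx => hξ x (hasZeroAt_smul hx _)
  obtain ⟨c, rfl⟩ := IsAlgClosed.exists_pow_nat_eq b (Nat.pos_of_ne_zero hq)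
  obtain ⟨v, hv, rfl⟩ := exists_pow_eq_of_isSmall_sub_one hw hq
  refine ⟨m, c, v, (pow_ne_zero_iff hq).1 hb, hv, ?_⟩
  rw [algebraMap_eq_monomial, val_unitT_zpow, ← mul_assoc, monomial_mul_monomial, zero_add,
    mul_one]

theorem isCoordinate_unitT_mul_expUnit {s : AnalyticFunction k I} (hs : IsSmall s) :
    IsCoordinate (unitT * expUnit s hs).val :=
  isCoordinate_unitT_mul (isSmall_exp_sub_one hs)

theorem val_unitT_mul_expUnit_zpow {s : AnalyticFunction k I} (hs : IsSmall s) (n : ℤ) :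
    ((unitT * expUnit s hs) ^ n).val = (unitT ^ n).val * exp ((n : k) • s) := by
  rw [mul_zpow, Units.val_mul, val_expUnit_zpow]

theorem exists_smul_dlogPow_eq_coeff_zero {v : AnalyticFunction k I} (hv : IsSmall (v - 1))
    (q : ℕ) :
    ∃ (s : AnalyticFunction k I) (hs : IsSmall s), v ^ q • dlogPow q unitT =
      algebraMap k (AnalyticFunction k I) (v.coeff 0 ^ q) • dlogPow q (unitT * expUnit s hs) := by
  obtain ⟨s, hs, hsv⟩ := exists_coeff_zero_smul_one_add_euler_eq hv
  refine ⟨s, hs, ?_⟩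
  rw [dlogPow_unitT_mul_expUnit, smul_smul, map_pow, ← mul_pow, ← Algebra.smul_def, hsv]

theorem exists_smul_dlogPow_eq_of_not_dvd {v : AnalyticFunction k I} (hv : IsSmall (v - 1)) {q : ℕ}
    (hq : q ≠ 0) {m : ℤ} (hm : ¬ (q : ℤ) ∣ m) :
    ∃ (s : AnalyticFunction k I) (hs : IsSmall s),
      ((unitT ^ m).val * v ^ q) • dlogPow q unitT =
        ((unitT * expUnit s hs) ^ m).val • dlogPow q (unitT * expUnit s hs) := by
  obtain ⟨s, hs, hsv⟩ := exists_exp_smul_mul_one_add_euler_eq hq hm hv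
  have norm_div_le : ‖(m : k) / q‖ ≤ 1 := by
    rw [norm_div, norm_natCast_eq_one_of_charZero_residueField hq, div_one]
    exact IsUltrametricDist.norm_intCast_le_one k m
  have := charZero_of_charZero_residueField k
  have exp_eq : exp ((m : k) • s) = exp (((m : k) / q) • s) ^ q := by
    rw [exp_pow (hs.smul norm_div_le), smul_smul, mul_div_cancel₀ _ (Nat.cast_ne_zero.2 hq)]
  refine ⟨s, hs, ?_⟩
  rw [dlogPow_unitT_mul_expUnit, smul_smul, val_unitT_mul_expUnit_zpow, exp_eq, mul_assoc,
    ← mul_pow, hsv]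

theorem exists_smul_dlogPow_eq_add_pow {v : AnalyticFunction k I} (hv : IsSmall (v - 1)) (q : ℕ)
    {d : ℤ} (hd : d ≠ 0) (c : k) :
    ∃ (s : AnalyticFunction k I) (hs : IsSmall s),
      (algebraMap k _ (c ^ q) * ((unitT ^ ((q : ℤ) * d)).val * v ^ q)) • dlogPow q unitT =
        (algebraMap k _ c * ((unitT * expUnit s hs) ^ d).val +
          algebraMap k _ (c * v.coeff (-d))) ^ q • dlogPow q (unitT * expUnit s hs) := by
  obtain ⟨s, hs, hsv⟩ := exists_exp_intCast_smul_add_monomial_mul_one_add_euler_eq hd hv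
  have algebraMap_coeff : algebraMap k (AnalyticFunction k I) (v.coeff (-d)) =
      (unitT ^ d).val * monomial (-d) (v.coeff (-d)) := by
    rw [val_unitT_zpow, monomial_mul_monomial, add_neg_cancel, one_mul, algebraMap_eq_monomial]
  refine ⟨s, hs, ?_⟩
  rw [dlogPow_unitT_mul_expUnit, smul_smul, mul_comm (q : ℤ), zpow_mul, zpow_natCast,
    Units.val_pow_eq_pow_val, map_pow, ← mul_pow, ← mul_pow, ← mul_pow, val_unitT_mul_expUnit_zpow,
    map_mul, algebraMap_coeff]
  nth_rewrite 1 [← hsv]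
  ring_nf

end NormalForm

end AnalyticFunction

end

open AnalyticFunction

theorem mainTheorem3 {k : Type*} [NormedField k] [IsUltrametricDist k] [CompleteSpace k]
    [IsAlgClosed k]
    [CharZero (IsLocalRing.ResidueField (NormedField.valuation (K := k)).valuationSubring)]
    (I : RadiusInterval) (q : ℕ) (hq : 0 < q) (ξ : QDifferential k I q)
    (hξ : ∀ x : BerkovichAnnulus k I, ¬ HasZeroAt ξ x) :
    ∃ t : (AnalyticFunction k I)ˣ, IsCoordinate (t : AnalyticFunction k I) ∧
      ((∃ (n : ℤ) (c c₀ : k), n ≠ 0 ∧ (q : ℤ) ∣ n ∧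
          (∀ x : BerkovichAnnulus k I,
            absAt x (algebraMap k _ c₀) <
              absAt x (algebraMap k _ c * ((t ^ (n / q) : (AnalyticFunction k I)ˣ) :
                AnalyticFunction k I))) ∧
          ξ = (algebraMap k _ c * ((t ^ (n / q) : (AnalyticFunction k I)ˣ) :
                AnalyticFunction k I) + algebraMap k _ c₀) ^ q • dlogPow q t) ∨
        (∃ (n : ℤ) (c : k),
          ξ = (algebraMap k _ (c ^ q) * ((t ^ n : (AnalyticFunction k I)ˣ) :
                AnalyticFunction k I)) • dlogPow q t)) := by
  by_cases hξ₀ : ξ = 0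
  · -- `ξ = 0` does not occur, but `c = 0` settles it without exhibiting a point of the annulus.
    refine ⟨unitT * expUnit 0 isSmall_zero, isCoordinate_unitT_mul_expUnit _, Or.inr ⟨0, 0, ?_⟩⟩
    rw [hξ₀, zero_pow hq.ne', map_zero, zero_mul, zero_smul]
  obtain ⟨m, c, v, hc, hv, ξ_eq⟩ := exists_eq_smul_dlogPow_of_forall_not_hasZeroAt hq.ne' hξ hξ₀
  by_cases hqm : (q : ℤ) ∣ m
  · obtain ⟨d, rfl⟩ := hqm
    have q_ne_zero : (q : ℤ) ≠ 0 := by exact_mod_cast hq.ne'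
    rcases eq_or_ne d 0 with rfl | hd
    · obtain ⟨s, hs, smul_eq⟩ := exists_smul_dlogPow_eq_coeff_zero hv q
      refine ⟨_, isCoordinate_unitT_mul_expUnit hs, Or.inr ⟨0, c * v.coeff 0, ?_⟩⟩
      rw [ξ_eq, mul_zero, zpow_zero, zpow_zero, Units.val_one, one_mul, mul_one, mul_smul,
        smul_eq, smul_smul, mul_pow, map_mul]
    · obtain ⟨s, hs, smul_eq⟩ := exists_smul_dlogPow_eq_add_pow hv q hd c
      refine ⟨_, isCoordinate_unitT_mul_expUnit hs, Or.inl ⟨q * d, c, c * v.coeff (-d),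
        mul_ne_zero q_ne_zero hd, dvd_mul_right _ _, ?_⟩⟩
      rw [Int.mul_ediv_cancel_left d q_ne_zero]
      exact ⟨absAt_algebraMap_mul_coeff_lt hc hv hd (isSmall_exp_sub_one hs), ξ_eq.trans smul_eq⟩
  · obtain ⟨s, hs, smul_eq⟩ := exists_smul_dlogPow_eq_of_not_dvd hv hq.ne' hqm
    refine ⟨_, isCoordinate_unitT_mul_expUnit hs, Or.inr ⟨m, c, ?_⟩⟩
    rw [ξ_eq, mul_smul, smul_eq, smul_smul]
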